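/- Let $q$ be a prime power. For a homogeneous polynomial $F\in\mathbb{F}_{q^2}[x_0,x_1,x_2,x_3]$ let $V(F)$ be its zero set in $\mathbb{P}^3$ over an algebraic closure of $\mathbb{F}_{q^2}$, and for a subset $Z\subseteq\mathbb{P}^3$ let $Z(\mathbb{F}_{q^2})$ be the set of its $\mathbb{F}_{q^2}$-rational points. Let $H=(h_{ij})$ be a $4\times 4$ Hermitian matrix over $\mathbb{F}_{q^2}$ (that is, $H\neq 0$ and $h_{ij}=h_{ji}^q$ for all $i,j$) of rank $3$, and let $P\mathcal{U}_2=V\big(\sum_{i,j}h_{ij}x_ix_j^q\big)$ be the corresponding degenerate Hermitian surface. It is a cone over a non-degenerate Hermitian curve whose vertex $P$ is the unique point $x$ with $x^TH=0$; this point is $\mathbb{F}_{q^2}$-rational. Let $F\in\mathbb{F}_{q^2}[x_0,x_1,x_2,x_3]$ be a nonzero homogeneous polynomial of degree $d$ with $1\le d\le q$. Then $$|(P\mathcal{U}_2\cap V(F))(\mathbb{F}_{q^2})|=1+q^2d(q+1)$$ if and only if $V(F)$ is a cone with vertex $P$ over a plane curve $\mathcal{C}$ defined over $\mathbb{F}_{q^2}$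 with $|(\mathcal{C}\cap P\mathcal{U}_2)(\mathbb{F}_{q^2})|=d(q+1)$; that is, if and only if there are a plane $E\subset\mathbb{P}^3$ defined over $\mathbb{F}_{q^2}$ with $P\notin E$, and a curve $\mathcal{C}\subset E$ cut out on $E$ by a homogeneous polynomial over $\mathbb{F}_{q^2}$ of positive degree not vanishing identically on $E$, such that $V(F)$ is the union of all lines joining $P$ to a point of $\mathcal{C}$ and $|(\mathcal{C}\cap P\mathcal{U}_2)(\mathbb{F}_{q^2})|=d(q+1)$. -/

import Mathlib

open scoped LinearAlgebra.Projectivization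

noncomputable section

namespace HermitianCone

/-- The set of geometric points of projective `n`-space over the field `K`, i.e. its points over
an algebraic closure of `K`, in homogeneous coordinates `x₀, …, xₙ`. -/
abbrev GeomPoint (K : Type*) [Field K] (n : ℕ) : Type _ :=
  ℙ (AlgebraicClosure K) (Fin (n + 1) → AlgebraicClosure K)

variable {K : Type*} [Field K] {n : ℕ}

/-- `V(F)`: the zero set in projective space (over the algebraic closure) of a polynomial `F` with
coefficients in `K`. It is used for homogeneous `F` only, for which the choice of the
representative `x.rep` is irrelevant. -/
def zeroSet (F : MvPolynomial (Fin (n + 1)) K) : Set (GeomPoint K n) :=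
  {x | MvPolynomial.aeval x.rep F = 0}

/-- The set `Z(K)` of `K`-rational points of `Z`: those points of `Z` that have homogeneous
coordinates in `K`. -/
def rationalPoints (Z : Set (GeomPoint K n)) : Set (GeomPoint K n) :=
  {x | x ∈ Z ∧ ∃ v : Fin (n + 1) → K,
    ∃ hv : (fun i => algebraMap K (AlgebraicClosure K) (v i)) ≠ 0,
      x = Projectivization.mk (AlgebraicClosure K) _ hv}

/-- A Hermitian matrix over a field with `q ^ 2` elements: `H ≠ 0` and `h_ij = h_ji ^ q`. -/
def IsHermitianMatrix (q : ℕ) (H : Matrix (Fin (n + 1)) (Fin (n + 1)) K) : Prop :=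
  H ≠ 0 ∧ ∀ i j, H i j = H j i ^ q

/-- The polynomial `xᵀ H x^(q) = ∑ h_ij x_i x_j ^ q`. -/
def hermitianPoly (q : ℕ) (H : Matrix (Fin (n + 1)) (Fin (n + 1)) K) :
    MvPolynomial (Fin (n + 1)) K :=
  ∑ i, ∑ j, MvPolynomial.C (H i j) * MvPolynomial.X i * MvPolynomial.X j ^ q

/-- The Hermitian variety of `H`. -/
def hermitianVariety (q : ℕ) (H : Matrix (Fin (n + 1)) (Fin (n + 1)) K) :
    Set (GeomPoint K n) :=
  zeroSet (hermitianPoly q H)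

/-- The singular space of the Hermitian variety of `H`: the points `x` with `xᵀ H = 0`.
If `H` is a Hermitian matrix of size `n + 1` and rank `n`, this is a single point, rational over
`K`: the vertex of the cone that the Hermitian variety is. -/
def singularSpace (H : Matrix (Fin (n + 1)) (Fin (n + 1)) K) : Set (GeomPoint K n) :=
  {x | Matrix.vecMul x.rep (H.map (algebraMap K (AlgebraicClosure K))) = 0}

/-- A hyperplane defined over `K` (a plane, for `n = 3`). -/
def IsHyperplane (E : Set (GeomPoint K n)) : Prop :=
  ∃ l : MvPolynomial (Fin (n + 1)) K, l.IsHomogeneous 1 ∧ l ≠ 0 ∧ E = zeroSet l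

/-- `C` is a hypersurface of `E`, defined over `K`: it is cut out on `E` by a form over `K` of
positive degree that does not vanish identically on `E`. For a plane `E` defined over `K`
this says that `C` is a plane curve in `E`, defined over `K`. -/
def IsHypersurfaceIn (E C : Set (GeomPoint K n)) : Prop :=
  ∃ (e : ℕ) (G : MvPolynomial (Fin (n + 1)) K),
    0 < e ∧ G.IsHomogeneous e ∧ ¬ E ⊆ zeroSet G ∧ C = E ∩ zeroSet G

/-- The cone over `C` with vertex `P`: the union of the lines joining `P` to the points of `C`. -/
def cone (P : GeomPoint K n) (C : Set (GeomPoint K n)) : Set (GeomPoint K n) :=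
  {x | ∃ y ∈ C, x.submodule ≤ P.submodule ⊔ y.submodule}

end HermitianCone

end

/-! Scale the vertex to a vector `p` with `p i = 1` and write every vector uniquely as `y + t p`
with `y` in the plane `x_i = 0`. The Hermitian form does not depend on `t`. It becomes the form of
the 3×3 minor `M` of `H`, which is non-degenerate, and `F(y + t p) = ∑ f_k(y) t^k` with `f_k` a form
of degree `d - k` (`lineExpansion`).

Suppose `t` occurs, with top exponent `m ≥ 1`. Over an isotropic `y` with `f_m(y) ≠ 0` there are at
most `m` values of `t`, and over any other isotropic `y` at most `q ^ 2`. Two bounds control the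
number of `y`. The Hermitian curve has at most `q^3 + q + 1` rational points (`card_isotropic_le`).
At most `(q + 1)(d - m)` of them lie on `f_m = 0`, by Bézout (`card_isotropic_zeros_le`), since the
Hermitian curve is irreducible of degree `q + 1 > d - m`. These bounds already keep the total
strictly below the stated value (`card_zeros_lt`), so equality forces `t` to be absent. Then `V(F)`
is the cone over its section by `x_i = 0` (`zeroSet_eq_cone`).

For a cone over a nonempty curve `C` in a plane off the vertex, the count is `1 + q^2 |C ∩ PU_2|`
(`ncard_rationalPoints_cone`). This yields the number of points of `C` in one direction and proves
the other direction outright.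

Bézout and irreducibility both come from comparing dimensions of graded pieces through the Koszul
syzygies of two plane forms. -/

namespace HermitianCone

open MvPolynomial

/-! ### Graded pieces, Koszul syzygies and Bézout's inequality. -/

section Homogeneous

variable {σ K : Type*} [Field K]

/-- The substitution `Xᵢ ↦ Xᵢ T`, which separates the homogeneous components of a polynomial. -/
noncomputable def homogenizer : MvPolynomial σ K →ₐ[K] Polynomial (MvPolynomial σ K) :=
  aeval fun i => Polynomial.C (X i) * Polynomial.X

theorem homogenizer_of_isHomogeneous {p : MvPolynomial σ K} {n : ℕ} (hp : p.IsHomogeneous n) :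
    homogenizer p = Polynomial.C p * Polynomial.X ^ n := by
  classical
  conv_lhs => rw [p.as_sum]
  conv_rhs => rw [p.as_sum]
  rw [map_sum, map_sum, Finset.sum_mul]
  refine Finset.sum_congr rfl fun s hs => ?_
  have hdeg : s.degree = n := by
    by_contra h
    exact (mem_support_iff.1 hs) (hp.coeff_eq_zero h)
  rw [homogenizer, aeval_monomial, monomial_eq, Finsupp.prod, Finsupp.prod, ← hdeg,
    Finsupp.degree_apply]
  simp only [mul_pow, Finset.prod_mul_distrib, Finset.prod_pow_eq_pow_sum, map_mul, map_prod,
    map_pow, mul_assoc]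
  rfl

theorem coeff_homogenizer (p : MvPolynomial σ K) (k : ℕ) :
    (homogenizer p).coeff k = homogeneousComponent k p := by
  classical
  conv_lhs => rw [← sum_homogeneousComponent p]
  rw [map_sum, Polynomial.finsetSum_coeff]
  simp_rw [homogenizer_of_isHomogeneous (homogeneousComponent_isHomogeneous _ p),
    Polynomial.coeff_C_mul_X_pow]
  rw [Finset.sum_ite_eq]
  split_ifs with h
  · rfl
  · rw [homogeneousComponent_eq_zero]
    simpa [Nat.lt_succ_iff] using h

/-- A factor of a nonzero homogeneous polynomial is homogeneous. -/
theorem exists_isHomogeneous_of_mul {A B : MvPolynomial σ K} {n : ℕ}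
    (h : (A * B).IsHomogeneous n) (h0 : A * B ≠ 0) :
    ∃ a b, A.IsHomogeneous a ∧ B.IsHomogeneous b ∧ a + b = n := by
  classical
  have hinj : ∀ p : MvPolynomial σ K, p ≠ 0 → homogenizer p ≠ 0 := by
    intro p hp hz
    apply hp
    rw [← sum_homogeneousComponent p]
    refine Finset.sum_eq_zero fun k _ => ?_
    rw [← coeff_homogenizer, hz, Polynomial.coeff_zero]
  have hA := hinj A (left_ne_zero_of_mul h0)
  have hB := hinj B (right_ne_zero_of_mul h0)
  have hAB := homogenizer_of_isHomogeneous h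
  rw [map_mul] at hAB
  -- Degree and trailing degree in the extra variable are both additive. They agree for the product,
  -- hence for each factor.
  have h1 : (homogenizer A).natDegree + (homogenizer B).natDegree = n := by
    rw [← Polynomial.natDegree_mul hA hB, hAB, Polynomial.natDegree_C_mul_X_pow _ _ h0]
  have h2 : (homogenizer A).natTrailingDegree + (homogenizer B).natTrailingDegree = n := by
    rw [← Polynomial.natTrailingDegree_mul hA hB, hAB, Polynomial.C_mul_X_pow_eq_monomial,
      Polynomial.natTrailingDegree_monomial h0]
  have h3 := Polynomial.natTrailingDegree_le_natDegree (homogenizer A)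
  have h4 := Polynomial.natTrailingDegree_le_natDegree (homogenizer B)
  have key : ∀ p : MvPolynomial σ K,
      (homogenizer p).natDegree = (homogenizer p).natTrailingDegree →
      p.IsHomogeneous (homogenizer p).natDegree := by
    intro p hp
    have : p = homogeneousComponent (homogenizer p).natDegree p := by
      conv_lhs => rw [← sum_homogeneousComponent p]
      rw [Finset.sum_eq_single (homogenizer p).natDegree]
      · intro k _ hk
        rw [← coeff_homogenizer]
        rcases lt_or_gt_of_ne hk with hk | hk
        · exact Polynomial.coeff_eq_zero_of_lt_natTrailingDegree (hp ▸ hk)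
        · exact Polynomial.coeff_eq_zero_of_natDegree_lt hk
      · intro hk
        rw [homogeneousComponent_eq_zero]
        simpa [Nat.lt_succ_iff] using hk
    have hh := homogeneousComponent_isHomogeneous (homogenizer p).natDegree p
    rwa [← this] at hh
  exact ⟨_, _, key A (by omega), key B (by omega), h1⟩

/-- Monomials form a basis, and stars and bars counts them. -/
theorem finrank_homogeneousSubmodule_fin_three (n : ℕ) :
    Module.finrank K (homogeneousSubmodule (Fin 3) K n) = (n + 2).choose 2 := by
  classical
  rw [homogeneousSubmodule_eq_finsupp_supported,
    (AddMonoidAlgebra.supportedEquivFinsupp {d : Fin 3 →₀ ℕ | d.degree = n}).finrank_eq]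
  have e : {d : Fin 3 →₀ ℕ | d.degree = n} = ((Finset.univ : Finset (Fin 3)).finsuppAntidiag n) := by
    ext d
    simp [Finset.mem_finsuppAntidiag, Finsupp.degree_eq_sum]
  rw [e]
  rw [Module.finrank_finsupp_self]
  simp only [Finset.coe_sort_coe, Fintype.card_coe, Finset.card_finsuppAntidiag_nat_eq_choose]
  rw [show (Finset.univ : Finset (Fin 3)).card + n - 1 = n + 2 by simp; omega]
  exact Nat.choose_symm_add

instance finiteDimensional_homogeneousSubmodule [Finite σ] (n : ℕ) :
    FiniteDimensional K (homogeneousSubmodule σ K n) :=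
  Module.Finite.of_fg (homogeneousSubmodule_fg σ K n)

/-- Multiplication by a form of degree `a`, from the forms of degree `m` to those of degree
`n = m + a`. -/
noncomputable def mulForm {A : MvPolynomial σ K} {a m n : ℕ} (hA : A.IsHomogeneous a)
    (h : a + m = n) : homogeneousSubmodule σ K m →ₗ[K] homogeneousSubmodule σ K n :=
  (LinearMap.mulLeft K A).restrict fun g hg => by
    have := hA.mul hg
    rw [h] at this
    exact this

@[simp] theorem coe_mulForm {A : MvPolynomial σ K} {a m n : ℕ} (hA : A.IsHomogeneous a)
    (h : a + m = n) (g : homogeneousSubmodule σ K m) : (mulForm hA h g : MvPolynomial σ K) = A * g :=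
  rfl

/-- The map `(g, k) ↦ A g + B k`, whose range is the degree `s + a + b` part of `(A, B)`. -/
noncomputable def combination {A B : MvPolynomial σ K} {a b : ℕ} (hA : A.IsHomogeneous a)
    (hB : B.IsHomogeneous b) (s : ℕ) :
    homogeneousSubmodule σ K (s + b) × homogeneousSubmodule σ K (s + a) →ₗ[K]
      homogeneousSubmodule σ K (s + a + b) :=
  (mulForm hA (by omega)).coprod (mulForm hB (by omega))

/-- The map `c ↦ (B c, - A c)`, the trivial syzygies of `(A, B)`. -/
noncomputable def koszul {A B : MvPolynomial σ K} {a b : ℕ} (hA : A.IsHomogeneous a)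
    (hB : B.IsHomogeneous b) (s : ℕ) :
    homogeneousSubmodule σ K s →ₗ[K]
      homogeneousSubmodule σ K (s + b) × homogeneousSubmodule σ K (s + a) :=
  (mulForm hB (by omega)).prod (-mulForm hA (by omega))

theorem range_koszul_le {A B : MvPolynomial σ K} {a b : ℕ} (hA : A.IsHomogeneous a)
    (hB : B.IsHomogeneous b) (s : ℕ) :
    LinearMap.range (koszul hA hB s) ≤ LinearMap.ker (combination hA hB s) := by
  rintro _ ⟨c, rfl⟩
  rw [LinearMap.mem_ker]
  apply Subtype.ext
  simp [koszul, combination]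
  ring

theorem koszul_injective {A B : MvPolynomial σ K} {a b : ℕ} (hA : A.IsHomogeneous a)
    (hB : B.IsHomogeneous b) (hA0 : A ≠ 0) (s : ℕ) : Function.Injective (koszul hA hB s) := by
  rw [← LinearMap.ker_eq_bot, LinearMap.ker_eq_bot']
  intro c hc
  have h2 := congrArg (fun x => (x.2 : MvPolynomial σ K)) hc
  apply Subtype.ext
  simpa [koszul, hA0] using h2

/-- An irreducible `A` is prime, so `A ∣ B k` forces `A ∣ k`: every syzygy is a trivial one. -/
theorem ker_combination_le {A B : MvPolynomial σ K} {a b : ℕ} (hA : A.IsHomogeneous a)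
    (hB : B.IsHomogeneous b) (hirr : Irreducible A) (hAB : ¬ A ∣ B) (s : ℕ) :
    LinearMap.ker (combination hA hB s) ≤ LinearMap.range (koszul hA hB s) := by
  rintro ⟨g, k⟩ hgk
  rw [LinearMap.mem_ker] at hgk
  have h1 : A * g.1 + B * k.1 = 0 := by
    simpa [combination] using congrArg Subtype.val hgk
  have h2 : A ∣ B * k.1 := ⟨-g.1, by linear_combination h1⟩
  obtain ⟨c, hc⟩ := ((UniqueFactorizationMonoid.irreducible_iff_prime.1 hirr).dvd_or_dvd
    h2).resolve_left hAB
  have hA0 : A ≠ 0 := hirr.ne_zero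
  have hcs : c.IsHomogeneous s := by
    by_cases hc0 : c = 0
    · rw [hc0]; exact isHomogeneous_zero _ _ _
    have hk : (A * c).IsHomogeneous (s + a) := hc ▸ k.2
    obtain ⟨a', b', h3, h4, h5⟩ := exists_isHomogeneous_of_mul hk (mul_ne_zero hA0 hc0)
    have := hA.inj_right h3 hA0
    rwa [show s = b' by omega]
  refine ⟨-⟨c, hcs⟩, ?_⟩
  have hg : g.1 = -(B * c) := by
    apply mul_left_cancel₀ hA0
    rw [hc] at h1
    linear_combination h1
  apply Prod.ext
  · apply Subtype.ext
    simp [koszul, hg]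
  · apply Subtype.ext
    simp [koszul, hc]

/-- The Euler characteristic of the Koszul complex in degree `s + a + b`: the codimension `a b` is
Bézout's number. -/
theorem choose_two_identity (s a b : ℕ) :
    (s + a + b + 2).choose 2 + (s + 2).choose 2 =
      (s + b + 2).choose 2 + (s + a + 2).choose 2 + a * b := by
  have h : ∀ n : ℕ, (n + 2).choose 2 * 2 = (n + 2) * (n + 1) := by
    intro n
    rw [Nat.choose_two_right]
    exact Nat.div_mul_cancel (Nat.even_mul_pred_self (n + 2)).two_dvd
  have h1 := h (s + a + b)
  have h2 := h s
  have h3 := h (s + b)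
  have h4 := h (s + a)
  nlinarith

/-- Two plane forms of positive degree do not generate all forms of a large degree. -/
theorem range_combination_ne_top {A B : MvPolynomial (Fin 3) K} {a b : ℕ}
    (hA : A.IsHomogeneous a) (hB : B.IsHomogeneous b) (hA0 : A ≠ 0) (ha : 0 < a) (hb : 0 < b)
    (s : ℕ) : LinearMap.range (combination hA hB s) ≠ ⊤ := by
  intro htop
  have h1 := LinearMap.finrank_range_add_finrank_ker (combination hA hB s)
  -- The trivial syzygies alone force codimension at least `a b > 0`, so no coprimality is needed.
  have h2 := Submodule.finrank_mono (range_koszul_le hA hB s)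
  rw [LinearMap.finrank_range_of_inj (koszul_injective hA hB hA0 s)] at h2
  rw [htop, finrank_top, Module.finrank_prod] at h1
  simp only [finrank_homogeneousSubmodule_fin_three] at h1 h2
  have h3 := choose_two_identity s a b
  have := Nat.mul_pos ha hb
  omega

/-- Pairwise distinct projective points are separated by the forms of any large enough degree. -/
theorem exists_form_eval_eq_single {ι : Type*} [Fintype ι] [DecidableEq ι] [Fintype σ]
    (z : ι → σ → K) (hz : ∀ i, z i ≠ 0)
    (hpair : ∀ i j, i ≠ j → z i ∉ Submodule.span K {z j}) (n : ℕ) (hn : Fintype.card ι ≤ n)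
    (i : ι) :
    ∃ g : MvPolynomial σ K, g.IsHomogeneous n ∧ eval (z i) g ≠ 0 ∧
      ∀ j, j ≠ i → eval (z j) g = 0 := by
  classical
  have hlin : ∀ f : Module.Dual K (σ → K), ∃ l : MvPolynomial σ K, l.IsHomogeneous 1 ∧
      ∀ v, eval v l = f v := by
    intro f
    refine ⟨∑ k, C (f (Pi.single k 1)) * X k, ?_, fun v => ?_⟩
    · exact IsHomogeneous.sum _ _ _ fun k _ => isHomogeneous_C_mul_X _ _
    · conv_rhs => rw [pi_eq_sum_univ' v]
      simp [mul_comm, map_sum]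
  have hsep : ∀ j, ∃ l : MvPolynomial σ K, l.IsHomogeneous 1 ∧ eval (z i) l ≠ 0 ∧
      (j ≠ i → eval (z j) l = 0) := by
    intro j
    by_cases hj : j = i
    · obtain ⟨k, hk⟩ := Function.ne_iff.1 (hz i)
      exact ⟨X k, isHomogeneous_X _ _, by simpa using hk, fun h => absurd hj h⟩
    · obtain ⟨f, hf, hf'⟩ := Submodule.exists_dual_map_eq_bot_of_notMem
        (hpair i j (Ne.symm hj)) inferInstance
      obtain ⟨l, hl, hlv⟩ := hlin f
      refine ⟨l, hl, by rwa [hlv], fun _ => ?_⟩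
      rw [hlv]
      have : f (z j) ∈ (Submodule.span K {z j}).map f :=
        Submodule.mem_map_of_mem (Submodule.mem_span_singleton_self _)
      rwa [hf', Submodule.mem_bot] at this
  choose l hl hl1 hl2 using hsep
  -- One linear form kills each other point. The power of `l i`, nonzero at `z i`, pads the degree
  -- to `n`.
  refine ⟨(∏ j, l j) * l i ^ (n - Fintype.card ι), ?_, ?_, ?_⟩
  · have h1 := (IsHomogeneous.prod Finset.univ l (fun _ => 1) fun j _ => hl j).mul
      ((hl i).pow (n - Fintype.card ι))
    convert h1 using 1
    simp
    omega
  · simp [map_prod, Finset.prod_ne_zero_iff, hl1]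
  · intro j hj
    rw [map_mul, map_prod, Finset.prod_eq_zero (Finset.mem_univ j) (hl2 j hj), zero_mul]

/-- Bézout's inequality for the rational points of an irreducible plane curve. -/
theorem card_le_mul_of_common_zeros {A B : MvPolynomial (Fin 3) K} {a b : ℕ}
    (hA : A.IsHomogeneous a) (hB : B.IsHomogeneous b) (hirr : Irreducible A) (hAB : ¬ A ∣ B)
    {ι : Type*} [Fintype ι] (z : ι → Fin 3 → K) (hz : ∀ i, z i ≠ 0)
    (hpair : ∀ i j, i ≠ j → z i ∉ Submodule.span K {z j})
    (hzA : ∀ i, eval (z i) A = 0) (hzB : ∀ i, eval (z i) B = 0) :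
    Fintype.card ι ≤ a * b := by
  classical
  set s := Fintype.card ι with hs
  let ev : homogeneousSubmodule (Fin 3) K (s + a + b) →ₗ[K] (ι → K) :=
    LinearMap.pi fun i => (aeval (z i)).toLinearMap ∘ₗ Submodule.subtype _
  have hev : ∀ g i, ev g i = eval (z i) g.1 := fun g i => by
    simp [ev]
  have hsurj : LinearMap.range ev = ⊤ := by
    rw [eq_top_iff, ← (Pi.basisFun K ι).span_eq, Submodule.span_le]
    rintro _ ⟨i, rfl⟩
    obtain ⟨g, hg, hg1, hg2⟩ := exists_form_eval_eq_single z hz hpair (s + a + b) (by omega) i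
    refine ⟨(eval (z i) g)⁻¹ • ⟨g, hg⟩, ?_⟩
    ext j
    rw [map_smul, Pi.smul_apply, hev, Pi.basisFun_apply]
    by_cases hj : j = i
    · subst hj
      simp [hg1]
    · simp [hg2 j hj, hj]
  -- The kernel of `ev` has codimension equal to the number of points and contains a space of
  -- codimension at most `a b`.
  have hle : LinearMap.range (combination hA hB s) ≤ LinearMap.ker ev := by
    rintro _ ⟨⟨g, k⟩, rfl⟩
    rw [LinearMap.mem_ker]
    ext i
    rw [hev]
    simp [combination, hzA, hzB]
  have h1 := LinearMap.finrank_range_add_finrank_ker (combination hA hB s)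
  have h2 := Submodule.finrank_mono (ker_combination_le hA hB hirr hAB s)
  rw [LinearMap.finrank_range_of_inj (koszul_injective hA hB hirr.ne_zero s)] at h2
  have h3 := LinearMap.finrank_range_add_finrank_ker ev
  have h4 := Submodule.finrank_mono hle
  rw [hsurj, finrank_top, Module.finrank_fintype_fun_eq_card] at h3
  rw [Module.finrank_prod] at h1
  simp only [finrank_homogeneousSubmodule_fin_three] at h1 h2 h3
  have h5 := choose_two_identity s a b
  omega

end Homogeneous

/-! ### The conjugation `x ↦ x ^ q` of the field with `q ^ 2` elements. -/

section FiniteField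

variable {K : Type*} [Field K] [Fintype K] {q : ℕ}

theorem two_le_of_card (hK : Fintype.card K = q ^ 2) : 2 ≤ q := by
  have := Fintype.one_lt_card (α := K)
  by_contra h
  interval_cases q <;> simp_all

/-- As a divisor of a power of the characteristic, `q` is itself such a power, so this map is an
iterated Frobenius. -/
theorem exists_ringHom_pow (hK : Fintype.card K = q ^ 2) :
    ∃ φ : K →+* K, ∀ x, φ x = x ^ q := by
  obtain ⟨p, hp⟩ := CharP.exists K
  obtain ⟨n, hprime, hn⟩ := FiniteField.card K p
  have : Fact p.Prime := ⟨hprime⟩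
  obtain ⟨k, -, hk⟩ := (Nat.dvd_prime_pow hprime).1
    (show q ∣ p ^ (n : ℕ) from ⟨q, by rw [← hn, hK, sq]⟩)
  exact ⟨iterateFrobenius K p k, fun x => by rw [iterateFrobenius_def, hk]⟩

theorem pow_pow_of_card (hK : Fintype.card K = q ^ 2) (x : K) : (x ^ q) ^ q = x := by
  rw [← pow_mul, ← sq, ← hK, FiniteField.pow_card]

theorem cast_eq_zero_of_card (hK : Fintype.card K = q ^ 2) : (q : K) = 0 := by
  have h := Nat.cast_card_eq_zero K
  rw [hK] at h
  simpa using h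

end FiniteField

/-! ### The sesquilinear form of a matrix. -/

section Sesquilinear

variable {K : Type*} [Field K] {m : Type*} [Fintype m] {q : ℕ}

/-- The value `∑ h_ij u_i v_j ^ q` of the sesquilinear form of the matrix `H`. -/
def sesq (q : ℕ) (H : Matrix m m K) (u v : m → K) : K :=
  ∑ i, ∑ j, H i j * u i * v j ^ q

theorem eval_hermitianPoly {n : ℕ} (H : Matrix (Fin (n + 1)) (Fin (n + 1)) K)
    (v : Fin (n + 1) → K) : eval v (hermitianPoly q H) = sesq q H v v := by
  simp [hermitianPoly, sesq]

theorem sesq_add_left (H : Matrix m m K) (u u' v : m → K) :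
    sesq q H (u + u') v = sesq q H u v + sesq q H u' v := by
  simp [sesq, mul_add, add_mul, Finset.sum_add_distrib]

theorem sesq_smul_left (H : Matrix m m K) (c : K) (u v : m → K) :
    sesq q H (c • u) v = c * sesq q H u v := by
  simp only [sesq, Pi.smul_apply, smul_eq_mul, Finset.mul_sum]
  exact Finset.sum_congr rfl fun i _ => Finset.sum_congr rfl fun j _ => by ring

theorem sesq_smul_right (H : Matrix m m K) (c : K) (u v : m → K) :
    sesq q H u (c • v) = c ^ q * sesq q H u v := by
  simp only [sesq, Pi.smul_apply, smul_eq_mul, Finset.mul_sum]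
  exact Finset.sum_congr rfl fun i _ => Finset.sum_congr rfl fun j _ => by ring

theorem sesq_eq_vecMul_dotProduct (H : Matrix m m K) (u v : m → K) :
    sesq q H u v = Matrix.vecMul u H ⬝ᵥ fun j => v j ^ q := by
  simp only [sesq, dotProduct, Matrix.vecMul, Finset.sum_mul]
  rw [Finset.sum_comm]
  exact Finset.sum_congr rfl fun i _ => Finset.sum_congr rfl fun j _ => by ring

theorem sesq_add_right [Fintype K] (hK : Fintype.card K = q ^ 2) (H : Matrix m m K)
    (u v v' : m → K) : sesq q H u (v + v') = sesq q H u v + sesq q H u v' := by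
  obtain ⟨φ, hφ⟩ := exists_ringHom_pow hK
  simp [sesq, ← hφ, mul_add, Finset.sum_add_distrib]

theorem sesq_pow [Fintype K] (hK : Fintype.card K = q ^ 2) {H : Matrix m m K}
    (hH : ∀ i j, H i j = H j i ^ q) (u v : m → K) : sesq q H u v ^ q = sesq q H v u := by
  obtain ⟨φ, hφ⟩ := exists_ringHom_pow hK
  simp only [sesq]
  rw [← hφ, map_sum, Finset.sum_comm]
  simp_rw [map_sum, map_mul, hφ]
  rw [Finset.sum_comm]
  conv_rhs => rw [Finset.sum_comm]
  refine Finset.sum_congr rfl fun i _ => Finset.sum_congr rfl fun j _ => ?_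
  rw [pow_pow_of_card hK, ← hH]
  ring

end Sesquilinear

/-! ### Irreducibility of the non-degenerate Hermitian curve. -/

section Irreducible

variable {K : Type*} [Field K] {q n : ℕ}

theorem hermitianPoly_isHomogeneous (q : ℕ) (H : Matrix (Fin (n + 1)) (Fin (n + 1)) K) :
    (hermitianPoly q H).IsHomogeneous (q + 1) := by
  refine IsHomogeneous.sum _ _ _ fun i _ => IsHomogeneous.sum _ _ _ fun j _ => ?_
  exact add_comm 1 q ▸ (isHomogeneous_C_mul_X (H i j) i).mul (isHomogeneous_X_pow j q)

theorem pderiv_hermitianPoly (hq : (q : K) = 0) (H : Matrix (Fin (n + 1)) (Fin (n + 1)) K)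
    (i : Fin (n + 1)) : pderiv i (hermitianPoly q H) = ∑ j, C (H i j) * X j ^ q := by
  have hq' : (q : MvPolynomial (Fin (n + 1)) K) = 0 := by
    rw [← map_natCast (C : K →+* MvPolynomial (Fin (n + 1)) K), hq, map_zero]
  simp only [hermitianPoly, map_sum, Derivation.leibniz, Derivation.leibniz_pow, pderiv_C,
    pderiv_X, smul_eq_mul, nsmul_eq_mul, hq', mul_zero, zero_mul, add_zero, zero_add]
  rw [Finset.sum_comm]
  refine Finset.sum_congr rfl fun j _ => ?_
  rw [Finset.sum_eq_single i]
  · simp [mul_comm]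
  · intro k _ hk
    simp [hk]
  · simp

/-- Since `q = 0` in `K`, the gradient is `H` applied to the vector of `q`-th powers, and inverting
`H` recovers those powers. -/
theorem sum_inv_mul_pderiv_hermitianPoly (hq : (q : K) = 0)
    {H : Matrix (Fin (n + 1)) (Fin (n + 1)) K} (hdet : IsUnit H.det) (m : Fin (n + 1)) :
    ∑ i, C (H⁻¹ m i) * pderiv i (hermitianPoly q H) = X m ^ q := by
  simp_rw [pderiv_hermitianPoly hq, Finset.mul_sum]
  rw [Finset.sum_comm]
  have h : ∀ j, ∑ i, (C (H⁻¹ m i) * (C (H i j) * X j ^ q) : MvPolynomial (Fin (n + 1)) K) =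
      C ((1 : Matrix (Fin (n + 1)) (Fin (n + 1)) K) m j) * X j ^ q := by
    intro j
    rw [← Matrix.nonsing_inv_mul H hdet, Matrix.mul_apply, map_sum, Finset.sum_mul]
    exact Finset.sum_congr rfl fun i _ => by rw [map_mul, mul_assoc]
  simp_rw [h, Matrix.one_apply]
  simp

theorem hermitianPoly_ne_zero (hq : (q : K) = 0)
    {H : Matrix (Fin (n + 1)) (Fin (n + 1)) K} (hdet : IsUnit H.det) : hermitianPoly q H ≠ 0 := by
  intro h
  have := sum_inv_mul_pderiv_hermitianPoly hq hdet 0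
  rw [h] at this
  simp only [map_zero, mul_zero, Finset.sum_const_zero] at this
  exact pow_ne_zero _ (X_ne_zero _) this.symm

theorem isUnit_of_isHomogeneous_zero {σ : Type*} {p : MvPolynomial σ K} (hp : p.IsHomogeneous 0)
    (h0 : p ≠ 0) : IsUnit p := by
  rw [← totalDegree_zero_iff_isHomogeneous, totalDegree_eq_zero_iff_eq_C] at hp
  rw [hp]
  refine IsUnit.map C (isUnit_iff_ne_zero.2 fun h => h0 ?_)
  rw [hp, h, map_zero]

/-- Curves `A` and `B` with product the Hermitian curve would have to meet, at a singular point of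
it. Algebraically, the Leibniz rule puts every `X m ^ q` in the ideal `(A, B)`, which then contains
all forms of large degree. -/
theorem irreducible_hermitianPoly (hq : (q : K) = 0) {H : Matrix (Fin 3) (Fin 3) K}
    (hdet : IsUnit H.det) : Irreducible (hermitianPoly (n := 2) q H) := by
  have h0 := hermitianPoly_ne_zero (n := 2) hq hdet
  have hhom := hermitianPoly_isHomogeneous (n := 2) q H
  rw [irreducible_iff]
  constructor
  · intro hu
    have h1 := hhom.totalDegree h0
    have h2 := isHomogeneous_one (Fin 3) K
    obtain ⟨v, hv⟩ := hu.exists_right_inv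
    rw [← hv] at h2
    obtain ⟨a, b, ha, -, hab⟩ := exists_isHomogeneous_of_mul h2 (by rw [hv]; exact one_ne_zero)
    have := hhom.inj_right ha h0
    omega
  · intro A B hAB
    rw [hAB] at hhom h0
    obtain ⟨a, b, ha, hb, hab⟩ := exists_isHomogeneous_of_mul hhom h0
    have hA0 := left_ne_zero_of_mul h0
    have hB0 := right_ne_zero_of_mul h0
    rcases Nat.eq_zero_or_pos a with rfl | ha0
    · exact Or.inl (isUnit_of_isHomogeneous_zero ha hA0)
    rcases Nat.eq_zero_or_pos b with rfl | hb0
    · exact Or.inr (isUnit_of_isHomogeneous_zero hb hB0)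
    exfalso
    refine range_combination_ne_top ha hb hA0 ha0 hb0 (3 * q) (eq_top_iff.2 ?_)
    have hpow : ∀ m : Fin 3, ∃ β α : MvPolynomial (Fin 3) K, β.IsHomogeneous (b - 1) ∧
        α.IsHomogeneous (a - 1) ∧ A * β + B * α = X m ^ q := by
      intro m
      refine ⟨∑ i, C (H⁻¹ m i) * pderiv i B, ∑ i, C (H⁻¹ m i) * pderiv i A,
        IsHomogeneous.sum _ _ _ fun i _ => hb.pderiv.C_mul _,
        IsHomogeneous.sum _ _ _ fun i _ => ha.pderiv.C_mul _, ?_⟩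
      rw [← sum_inv_mul_pderiv_hermitianPoly (n := 2) hq hdet m, hAB, Finset.mul_sum,
        Finset.mul_sum, ← Finset.sum_add_distrib]
      refine Finset.sum_congr rfl fun i _ => ?_
      rw [Derivation.leibniz, smul_eq_mul, smul_eq_mul]
      ring
    have hmon : ∀ (s : Fin 3 →₀ ℕ) (c : K) (hs : s.degree = 3 * q + a + b),
        (⟨monomial s c, isHomogeneous_monomial c hs⟩ :
          homogeneousSubmodule (Fin 3) K (3 * q + a + b)) ∈
          LinearMap.range (combination ha hb (3 * q)) := by
      intro s c hs
      -- Pigeonhole: three exponents with sum at least `3 * q`. This is why the Koszul shift is `3 *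
      -- q`.
      obtain ⟨m, hm⟩ : ∃ m, q ≤ s m := by
        by_contra! hlt
        have := hlt 0
        have := hlt 1
        have := hlt 2
        rw [Finsupp.degree_eq_sum, Fin.sum_univ_three] at hs
        omega
      obtain ⟨β, α, hβ, hα, hβα⟩ := hpow m
      have hsm : s - Finsupp.single m q + Finsupp.single m q = s :=
        tsub_add_cancel_of_le (Finsupp.single_le_iff.2 hm)
      have hdeg : (s - Finsupp.single m q).degree = 2 * q + a + b := by
        have := congrArg Finsupp.degree hsm
        rw [map_add, Finsupp.degree_single] at this
        omega
      have hmono := isHomogeneous_monomial c hdeg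
      refine ⟨(⟨β * monomial (s - Finsupp.single m q) c, ?_⟩,
        ⟨α * monomial (s - Finsupp.single m q) c, ?_⟩), ?_⟩
      · have := hβ.mul hmono
        rwa [show b - 1 + (2 * q + a + b) = 3 * q + b by omega] at this
      · have := hα.mul hmono
        rwa [show a - 1 + (2 * q + a + b) = 3 * q + a by omega] at this
      · apply Subtype.ext
        simp only [combination, LinearMap.coprod_apply, Submodule.coe_add, coe_mulForm]
        rw [← mul_assoc, ← mul_assoc, ← add_mul, hβα, X_pow_eq_monomial, monomial_mul, one_mul,
          add_comm (Finsupp.single m q), hsm]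
    rintro ⟨p, hp⟩ -
    have hdeg : ∀ s : p.support, s.1.degree = 3 * q + a + b := fun s => by
      by_contra h
      exact (mem_support_iff.1 s.2) (IsHomogeneous.coeff_eq_zero hp h)
    have hsum : (⟨p, hp⟩ : homogeneousSubmodule (Fin 3) K (3 * q + a + b)) =
        ∑ s ∈ p.support.attach, ⟨monomial s.1 (coeff s.1 p), isHomogeneous_monomial _
          (hdeg s)⟩ := by
      apply Subtype.ext
      rw [Submodule.coe_sum]
      exact p.as_sum.trans (Finset.sum_attach _ _).symm
    rw [hsum]
    exact Submodule.sum_mem _ fun s _ => hmon _ _ (hdeg s)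

end Irreducible

theorem aeval_smul_of_isHomogeneous {σ K A : Type*} [Field K] [CommRing A] [Algebra K A]
    {p : MvPolynomial σ K} {n : ℕ} (hp : p.IsHomogeneous n) (c : A) (v : σ → A) :
    aeval (c • v) p = c ^ n * aeval v p := by
  classical
  conv_lhs => rw [p.as_sum]
  conv_rhs => rw [p.as_sum]
  rw [map_sum, map_sum, Finset.mul_sum]
  refine Finset.sum_congr rfl fun s hs => ?_
  have hdeg : s.degree = n := by
    by_contra h
    exact (mem_support_iff.1 hs) (hp.coeff_eq_zero h)
  rw [aeval_monomial, aeval_monomial, Finsupp.prod, Finsupp.prod, ← hdeg, Finsupp.degree_apply]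
  simp only [Pi.smul_apply, smul_eq_mul, mul_pow, Finset.prod_mul_distrib,
    Finset.prod_pow_eq_pow_sum]
  ring

/-! ### Coordinates adapted to projection from a point. -/

section Coordinates

variable {R : Type*} [CommRing R] {n : ℕ}

/-- The embedding of the coordinate hyperplane `x_i = 0`. -/
def planeEmb (i : Fin (n + 1)) (y : Fin n → R) : Fin (n + 1) → R :=
  i.insertNth 0 y

@[simp] theorem planeEmb_self (i : Fin (n + 1)) (y : Fin n → R) : planeEmb i y i = 0 := by
  simp [planeEmb]

@[simp] theorem planeEmb_succAbove (i : Fin (n + 1)) (y : Fin n → R) (j : Fin n) :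
    planeEmb i y (i.succAbove j) = y j := by
  simp [planeEmb]

theorem planeEmb_zero (i : Fin (n + 1)) : planeEmb i (0 : Fin n → R) = 0 := by
  ext k
  induction k using i.succAboveCases <;> simp

theorem planeEmb_eq_zero_iff {i : Fin (n + 1)} {y : Fin n → R} : planeEmb i y = 0 ↔ y = 0 := by
  constructor
  · intro h
    ext j
    simpa using congrFun h (i.succAbove j)
  · rintro rfl
    exact planeEmb_zero i

/-- The coordinates `(y, t)` of the vector `y + t p`, where `y` lies in the plane `x_i = 0` and
`p_i = 1`. -/
def coneEquiv (p : Fin (n + 1) → R) (i : Fin (n + 1)) (hp : p i = 1) :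
    (Fin n → R) × R ≃ (Fin (n + 1) → R) where
  toFun x := planeEmb i x.1 + x.2 • p
  invFun v := (fun j => v (i.succAbove j) - v i * p (i.succAbove j), v i)
  left_inv x := by
    ext j <;> simp [hp]
  right_inv v := by
    ext k
    induction k using i.succAboveCases <;> simp [hp]

theorem coneEquiv_apply (p : Fin (n + 1) → R) (i : Fin (n + 1)) (hp : p i = 1)
    (y : Fin n → R) (t : R) : coneEquiv p i hp (y, t) = planeEmb i y + t • p := rfl

theorem card_filter_eq_sum_lines [Fintype R] [DecidableEq R] (p : Fin (n + 1) → R)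
    (i : Fin (n + 1)) (hp : p i = 1) (Q : (Fin (n + 1) → R) → Prop) [DecidablePred Q] :
    (Finset.univ.filter Q).card =
      ∑ y : Fin n → R, (Finset.univ.filter fun t : R => Q (planeEmb i y + t • p)).card := by
  simp_rw [Finset.card_filter]
  rw [← (coneEquiv p i hp).sum_comp, Fintype.sum_prod_type]
  rfl

end Coordinates

/-! ### Counting vectors on the Hermitian curve. -/

section Curve

variable {K : Type*} [Field K] [Fintype K] {q : ℕ}

/-- With `q ≥ 2` the exponents `0`, `1`, `q` are distinct, so the polynomial is nonzero. -/
theorem card_roots_le (hq : 2 ≤ q) {a b c : K} (h : ¬ (a = 0 ∧ b = 0 ∧ c = 0)) [DecidableEq K] :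
    (Finset.univ.filter fun t : K => a + t * b + t ^ q * c = 0).card ≤ q := by
  classical
  set f : Polynomial K :=
    Polynomial.C c * Polynomial.X ^ q + Polynomial.C b * Polynomial.X + Polynomial.C a with hf
  have hf0 : f ≠ 0 := by
    intro h0
    apply h
    have hc : ∀ k, f.coeff k = 0 := fun k => by rw [h0, Polynomial.coeff_zero]
    have h1 := hc 0
    have h2 := hc 1
    have h3 := hc q
    have hq0 : q ≠ 0 := by omega
    have hq1 : q ≠ 1 := by omega
    simp [hf, Polynomial.coeff_X_pow, Polynomial.coeff_X, Polynomial.coeff_C, hq0, hq0.symm,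
      hq1.symm] at h1 h2 h3
    exact ⟨h1, h2, h3⟩
  have hdeg : f.natDegree ≤ q := by
    rw [hf]
    compute_degree
    omega
  calc _ ≤ f.roots.toFinset.card := by
        refine Finset.card_le_card fun t ht => ?_
        rw [Multiset.mem_toFinset, Polynomial.mem_roots hf0]
        simp only [Finset.mem_filter, Finset.mem_univ, true_and] at ht
        simp only [hf, Polynomial.IsRoot, Polynomial.eval_add, Polynomial.eval_mul,
          Polynomial.eval_C, Polynomial.eval_pow, Polynomial.eval_X]
        linear_combination ht
    _ ≤ Multiset.card f.roots := Multiset.toFinset_card_le _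
    _ ≤ q := (Polynomial.card_roots' f).trans hdeg

/-- A non-degenerate Hermitian form in three variables has no totally isotropic plane. -/
theorem not_totally_isotropic (hK : Fintype.card K = q ^ 2) {M : Matrix (Fin 3) (Fin 3) K}
    (hdet : IsUnit M.det) {u v : Fin 3 → K} (huv : LinearIndependent K ![u, v])
    (huu : sesq q M u u = 0) (huv0 : sesq q M u v = 0) (hvu0 : sesq q M v u = 0)
    (hvv : sesq q M v v = 0) : False := by
  obtain ⟨φ, hφ⟩ := exists_ringHom_pow hK
  have hφφ : ∀ x, φ (φ x) = x := fun x => by rw [hφ, hφ, pow_pow_of_card hK]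
  let A : Matrix (Fin 2) (Fin 3) K := Matrix.of ![u, v]
  have hA : A.rank = 2 := by
    simpa using LinearIndependent.rank_matrix (M := A) huv
  have hA' : (A.map φ).rank = 2 := by
    have : LinearIndependent K (A.map φ).row := by
      rw [Fintype.linearIndependent_iff] at huv ⊢
      intro g hg i
      have h1 := huv (fun i => φ (g i)) (by
        ext j
        have := congrArg φ (congrFun hg j)
        simpa [A, Fin.sum_univ_two, hφφ] using this) i
      rw [← hφφ (g i), h1, map_zero]
    simpa using LinearIndependent.rank_matrix this
  -- Isotropy says that `A * M` times the conjugate transpose of `A` vanishes, but ranks 2 and 2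
  -- exceed the inner dimension 3.
  have hAM : (A * M).rank = 2 := by
    rw [Matrix.rank_mul_eq_left_of_isUnit_det M A hdet, hA]
  have hmul : A * M * (A.map φ).transpose = 0 := by
    ext i j
    have : (A * M * (A.map φ).transpose) i j = sesq q M (A i) (A j) := by
      rw [sesq_eq_vecMul_dotProduct]
      simp [Matrix.mul_apply, dotProduct, Matrix.vecMul, hφ]
    rw [this]
    fin_cases i <;> fin_cases j
    exacts [huu, huv0, hvu0, hvv]
  have h := Matrix.rank_add_rank_le_card_of_mul_eq_zero hmul
  rw [hAM, Matrix.rank_transpose, hA'] at h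
  simp at h

/-- An upper bound for the number of vectors on the cone over a non-degenerate Hermitian curve. -/
theorem card_isotropic_le (hK : Fintype.card K = q ^ 2) [DecidableEq K]
    {M : Matrix (Fin 3) (Fin 3) K}
    (hdet : IsUnit M.det) :
    (Finset.univ.filter fun y : Fin 3 → K => sesq q M y y = 0 ∧ y ≠ 0).card ≤
      (q ^ 2 - 1) * (q ^ 3 + q + 1) := by
  classical
  have hq := two_le_of_card hK
  rcases Finset.eq_empty_or_nonempty
    (Finset.univ.filter fun y : Fin 3 → K => sesq q M y y = 0 ∧ y ≠ 0) with h | ⟨R', hR'⟩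
  · rw [h]; simp
  simp only [Finset.mem_filter, Finset.mem_univ, true_and] at hR'
  obtain ⟨hR'0, hR'ne⟩ := hR'
  obtain ⟨i, hi⟩ := Function.ne_iff.1 hR'ne
  simp only [Pi.zero_apply] at hi
  obtain ⟨R, hR0, hRi⟩ : ∃ R : Fin 3 → K, sesq q M R R = 0 ∧ R i = 1 :=
    ⟨(R' i)⁻¹ • R', by rw [sesq_smul_left, sesq_smul_right, hR'0, mul_zero, mul_zero],
      by simp [hi]⟩
  -- On a line through the isotropic point `R` the form is `a + t b + t^q c`. If it vanished
  -- identically, the line would be totally isotropic.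
  have hline : ∀ y : Fin 2 → K, y ≠ 0 → (Finset.univ.filter fun t : K =>
      sesq q M (planeEmb i y + t • R) (planeEmb i y + t • R) = 0).card ≤ q := by
    intro y hy
    have hexp : ∀ t : K, sesq q M (planeEmb i y + t • R) (planeEmb i y + t • R) =
        sesq q M (planeEmb i y) (planeEmb i y) + t * sesq q M R (planeEmb i y) +
          t ^ q * sesq q M (planeEmb i y) R := by
      intro t
      rw [sesq_add_left, sesq_add_right hK, sesq_add_right hK, sesq_smul_left, sesq_smul_left,
        sesq_smul_right, sesq_smul_right, hR0]
      ring
    simp_rw [hexp]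
    apply card_roots_le hq
    rintro ⟨h1, h2, h3⟩
    refine not_totally_isotropic hK hdet (u := R) (v := planeEmb i y) ?_ hR0 h2 h3 h1
    rw [LinearIndependent.pair_iff]
    intro a b hab
    have ha : a = 0 := by simpa [hRi] using congrFun hab i
    refine ⟨ha, ?_⟩
    by_contra hb
    rw [ha, zero_smul, zero_add, smul_eq_zero, or_iff_right hb, planeEmb_eq_zero_iff] at hab
    exact hy hab
  have hcount := card_filter_eq_sum_lines R i hRi (fun y => sesq q M y y = 0)
  have hsum : ∑ y : Fin 2 → K, (Finset.univ.filter fun t : K =>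
      sesq q M (planeEmb i y + t • R) (planeEmb i y + t • R) = 0).card ≤
      q ^ 2 + (q ^ 4 - 1) * q := by
    rw [← Finset.add_sum_erase _ _ (Finset.mem_univ 0)]
    refine add_le_add ?_ ?_
    · refine (Finset.card_le_univ _).trans hK.le
    · refine (Finset.sum_le_card_nsmul _ _ q fun y hy => hline y (Finset.ne_of_mem_erase hy)).trans
        (le_of_eq ?_)
      rw [Finset.card_erase_of_mem (Finset.mem_univ _), Finset.card_univ, Fintype.card_fun, hK,
        Fintype.card_fin, smul_eq_mul, ← pow_mul]
  have hzero : (Finset.univ.filter fun y : Fin 3 → K => sesq q M y y = 0 ∧ y ≠ 0).card + 1 =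
      (Finset.univ.filter fun y : Fin 3 → K => sesq q M y y = 0).card := by
    rw [← Finset.filter_filter, Finset.filter_ne', Finset.card_erase_add_one]
    exact Finset.mem_filter.2 ⟨Finset.mem_univ _, by simp [sesq]⟩
  rw [hcount] at hzero
  have h4 : 1 ≤ q ^ 4 := Nat.one_le_pow _ _ (by omega)
  have h2 : 1 ≤ q ^ 2 := Nat.one_le_pow _ _ (by omega)
  zify [h4, h2] at hsum hzero ⊢
  nlinarith

/-- The number of nonzero rational vectors on a nondegenerate Hermitian curve and on another curve
of degree `e ≤ q`. -/
theorem card_isotropic_zeros_le (hK : Fintype.card K = q ^ 2) [DecidableEq K]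
    {M : Matrix (Fin 3) (Fin 3) K} (hdet : IsUnit M.det) {e : ℕ} (he : e ≤ q)
    {G : MvPolynomial (Fin 3) K} (hG : G.IsHomogeneous e) (hG0 : G ≠ 0) :
    (Finset.univ.filter fun y : Fin 3 → K => sesq q M y y = 0 ∧ eval y G = 0 ∧ y ≠ 0).card ≤
      (q ^ 2 - 1) * ((q + 1) * e) := by
  classical
  set h := hermitianPoly (n := 2) q M with hh
  have hhom : h.IsHomogeneous (q + 1) := hermitianPoly_isHomogeneous (n := 2) q M
  have hirr : Irreducible h := irreducible_hermitianPoly (cast_eq_zero_of_card hK) hdet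
  -- Degrees exclude this: `q + 1 > e`.
  have hdvd : ¬ h ∣ G := by
    rintro ⟨c, rfl⟩
    obtain ⟨a, b, ha, -, hab⟩ := exists_isHomogeneous_of_mul hG hG0
    have := hhom.inj_right ha hirr.ne_zero
    omega
  let ι := {x : ℙ K (Fin 3 → K) // eval x.rep h = 0 ∧ eval x.rep G = 0}
  have : Fintype ι := Fintype.ofFinite _
  have hι : Fintype.card ι ≤ (q + 1) * e := by
    refine card_le_mul_of_common_zeros hhom hG hirr hdvd (fun x : ι => x.1.rep)
      (fun x => x.1.rep_nonzero) ?_ (fun x => x.2.1) (fun x => x.2.2)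
    intro x y hxy hmem
    obtain ⟨a, ha⟩ := Submodule.mem_span_singleton.1 hmem
    apply hxy
    apply Subtype.ext
    rw [← x.1.mk_rep, ← y.1.mk_rep, Projectivization.mk_eq_mk_iff']
    exact ⟨a, ha⟩
  have hscale : ∀ {m : ℕ} {p : MvPolynomial (Fin 3) K}, p.IsHomogeneous m →
      ∀ (a : Kˣ) (v : Fin 3 → K), eval v p = 0 → eval (a • v) p = 0 := by
    intro m p hp a v hv
    have h := aeval_smul_of_isHomogeneous hp (a : K) v
    rw [aeval_eq_eval, aeval_eq_eval, hv, mul_zero] at h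
    exact h
  choose a ha using fun v : {v : Fin 3 → K // v ≠ 0} =>
    Projectivization.exists_smul_eq_mk_rep K v.1 v.2
  let S := {y : Fin 3 → K // sesq q M y y = 0 ∧ eval y G = 0 ∧ y ≠ 0}
  let f : S → ι × Kˣ := fun y => (⟨Projectivization.mk K y.1 y.2.2.2, by
    rw [← ha ⟨y.1, y.2.2.2⟩]
    exact ⟨hscale hhom _ _ (by rw [hh, eval_hermitianPoly (n := 2)]; exact y.2.1),
      hscale hG _ _ y.2.2.1⟩⟩, a ⟨y.1, y.2.2.2⟩)
  -- A vector is determined by its projective point and the unit carrying it to the chosen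
  -- representative.
  have hf : Function.Injective f := by
    intro y z hyz
    have h0 : Projectivization.mk K y.1 y.2.2.2 = Projectivization.mk K z.1 z.2.2.2 :=
      congrArg (fun x => x.1.1) hyz
    have h1 : a ⟨y.1, y.2.2.2⟩ = a ⟨z.1, z.2.2.2⟩ := congrArg Prod.snd hyz
    have h2 : a ⟨y.1, y.2.2.2⟩ • y.1 = a ⟨z.1, z.2.2.2⟩ • z.1 :=
      (ha ⟨y.1, y.2.2.2⟩).trans ((congrArg _ h0).trans (ha ⟨z.1, z.2.2.2⟩).symm)
    rw [h1] at h2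
    exact Subtype.ext (smul_left_cancel _ h2)
  have hcard := Fintype.card_le_of_injective f hf
  rw [Fintype.card_prod, Fintype.card_units, hK, Fintype.card_subtype] at hcard
  refine hcard.trans ?_
  rw [mul_comm]
  exact Nat.mul_le_mul_left _ hι

end Curve

/-! ### Expansion of a form along the lines through the vertex. -/

section Expansion

variable {K : Type*} [Field K] {n : ℕ}

/-- The expansion of `F(y + t p)` as a polynomial in `t` with coefficients in the ring of
polynomials in `y`, where `y` lies in the plane `x_i = 0`. -/
noncomputable def lineExpansion (p : Fin (n + 1) → K) (i : Fin (n + 1)) :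
    MvPolynomial (Fin (n + 1)) K →ₐ[K] Polynomial (MvPolynomial (Fin n) K) :=
  (finSuccEquiv K n).toAlgHom.comp
    (aeval (i.insertNth (X 0) fun j => X j.succ + C (p (i.succAbove j)) * X 0))

theorem eval_lineExpansion {A : Type*} [CommRing A] [Algebra K A] (p : Fin (n + 1) → K)
    (i : Fin (n + 1)) (hp : p i = 1) (y : Fin n → A) (t : A)
    (F : MvPolynomial (Fin (n + 1)) K) :
    aeval (planeEmb i y + t • fun k => algebraMap K A (p k)) F =
      (lineExpansion p i F).eval₂ (aeval y : MvPolynomial (Fin n) K →ₐ[K] A).toRingHom t := by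
  have h : (aeval (planeEmb i y + t • fun k => algebraMap K A (p k)) :
      MvPolynomial (Fin (n + 1)) K →ₐ[K] A).toRingHom =
      (Polynomial.eval₂RingHom (aeval y : MvPolynomial (Fin n) K →ₐ[K] A).toRingHom t).comp
        (lineExpansion p i).toRingHom := by
    apply MvPolynomial.ringHom_ext
    · intro c
      simp [lineExpansion, finSuccEquiv_apply]
    · intro k
      induction k using i.succAboveCases
      · simp [lineExpansion, finSuccEquiv_apply, hp]
      · simp [lineExpansion, finSuccEquiv_X_zero, finSuccEquiv_X_succ]
        simp [finSuccEquiv_apply]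
        ring
  exact congrArg (fun f => f F) h

/-- Evaluating the expansion at the generic point `X`, split as `y + t p`, gives back `F`. -/
theorem lineExpansion_injective (p : Fin (n + 1) → K) (i : Fin (n + 1)) (hp : p i = 1) :
    Function.Injective (lineExpansion p i) := by
  rw [injective_iff_map_eq_zero]
  intro F hF
  let p' : Fin (n + 1) → MvPolynomial (Fin (n + 1)) K := fun k => algebraMap K _ (p k)
  have hp' : p' i = 1 := by simp [p', hp]
  have h := eval_lineExpansion (A := MvPolynomial (Fin (n + 1)) K) p i hp
    ((coneEquiv p' i hp').symm X).1 ((coneEquiv p' i hp').symm X).2 F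
  rw [hF, Polynomial.eval₂_zero] at h
  have h2 : planeEmb i ((coneEquiv p' i hp').symm X).1 + ((coneEquiv p' i hp').symm X).2 • p' = X :=
    (coneEquiv p' i hp').apply_symm_apply X
  change aeval (planeEmb i ((coneEquiv p' i hp').symm X).1 +
    ((coneEquiv p' i hp').symm X).2 • p') F = 0 at h
  rwa [h2, aeval_X_left_apply] at h

theorem isHomogeneous_line_substitution (p : Fin (n + 1) → K) (i : Fin (n + 1))
    {F : MvPolynomial (Fin (n + 1)) K} {d : ℕ} (hF : F.IsHomogeneous d) :
    (aeval (i.insertNth (X 0) fun j => X j.succ + C (p (i.succAbove j)) * X 0) F :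
      MvPolynomial (Fin (n + 1)) K).IsHomogeneous d := by
  have := hF.aeval (n := 1)
    (i.insertNth (X 0 : MvPolynomial (Fin (n + 1)) K)
      fun j => X j.succ + C (p (i.succAbove j)) * X 0) (fun k => by
    induction k using i.succAboveCases
    · simpa using isHomogeneous_X _ _
    · simpa using (isHomogeneous_X _ _).add (isHomogeneous_C_mul_X _ _))
  rwa [one_mul] at this

theorem lineExpansion_coeff_isHomogeneous (p : Fin (n + 1) → K) (i : Fin (n + 1))
    {F : MvPolynomial (Fin (n + 1)) K} {d : ℕ} (hF : F.IsHomogeneous d) {k : ℕ} (hk : k ≤ d) :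
    ((lineExpansion p i F).coeff k).IsHomogeneous (d - k) :=
  (isHomogeneous_line_substitution p i hF).finSuccEquiv_coeff_isHomogeneous k (d - k) (by omega)

theorem natDegree_lineExpansion_le (p : Fin (n + 1) → K) (i : Fin (n + 1))
    {F : MvPolynomial (Fin (n + 1)) K} {d : ℕ} (hF : F.IsHomogeneous d) :
    (lineExpansion p i F).natDegree ≤ d := by
  refine (natDegree_finSuccEquiv _).trans_le ?_
  exact (degreeOf_le_totalDegree _ _).trans (isHomogeneous_line_substitution p i hF).totalDegree_le

theorem sesq_planeEmb {q : ℕ} (hq : q ≠ 0) (H : Matrix (Fin (n + 1)) (Fin (n + 1)) K) (i : Fin (n + 1))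
    (y z : Fin n → K) :
    sesq q H (planeEmb i y) (planeEmb i z) =
      sesq q (H.submatrix i.succAbove i.succAbove) y z := by
  simp [sesq, Fin.sum_univ_succAbove _ i, hq]

end Expansion

/-! ### The Hermitian cone and the strict upper bound. -/

section Hermitian

variable {K : Type*} [Field K] [Fintype K] {q n : ℕ}

theorem sesq_right_eq_zero (hK : Fintype.card K = q ^ 2)
    {H : Matrix (Fin (n + 1)) (Fin (n + 1)) K} (hH : ∀ i j, H i j = H j i ^ q)
    {p : Fin (n + 1) → K} (hp : Matrix.vecMul p H = 0) (u : Fin (n + 1) → K) :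
    sesq q H u p = 0 := by
  rw [← sesq_pow hK hH, sesq_eq_vecMul_dotProduct, hp, zero_dotProduct, zero_pow]
  have := two_le_of_card hK
  omega

theorem sesq_add_smul_self (hK : Fintype.card K = q ^ 2)
    {H : Matrix (Fin (n + 1)) (Fin (n + 1)) K} (hH : ∀ i j, H i j = H j i ^ q)
    {p : Fin (n + 1) → K} (hp : Matrix.vecMul p H = 0) (u : Fin (n + 1) → K) (t : K) :
    sesq q H (u + t • p) (u + t • p) = sesq q H u u := by
  rw [sesq_add_left, sesq_add_right hK, sesq_smul_left, sesq_smul_right,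
    sesq_right_eq_zero hK hH hp, sesq_eq_vecMul_dotProduct H p, hp, zero_dotProduct, mul_zero,
    mul_zero, add_zero, add_zero]

/-- A kernel vector of the minor, padded with `0`, lies in the left kernel of `H`: the remaining
column follows from orthogonality to `p`. It is then a multiple of `p` with `i`-th coordinate `0`,
hence zero. -/
theorem isUnit_det_submatrix (hK : Fintype.card K = q ^ 2)
    {H : Matrix (Fin (n + 1)) (Fin (n + 1)) K} (hH : ∀ i j, H i j = H j i ^ q)
    {p : Fin (n + 1) → K} (hp : Matrix.vecMul p H = 0) {i : Fin (n + 1)} (hpi : p i = 1)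
    (hker : ∀ v, Matrix.vecMul v H = 0 → ∃ c : K, v = c • p) :
    IsUnit (H.submatrix i.succAbove i.succAbove).det := by
  rw [isUnit_iff_ne_zero]
  intro hdet
  obtain ⟨w, hw0, hw⟩ := Matrix.exists_vecMul_eq_zero_iff.2 hdet
  have h1 : ∀ j, Matrix.vecMul (planeEmb i w) H (i.succAbove j) = 0 := by
    intro j
    have := congrFun hw j
    simpa [Matrix.vecMul, dotProduct, Fin.sum_univ_succAbove _ i] using this
  have h2 : Matrix.vecMul (planeEmb i w) H = 0 := by
    ext k
    induction k using i.succAboveCases with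
    | x =>
      have h3 := sesq_right_eq_zero hK hH hp (planeEmb i w)
      rw [sesq_eq_vecMul_dotProduct, dotProduct, Fin.sum_univ_succAbove _ i] at h3
      simpa [h1, hpi] using h3
    | p j => exact h1 j
  obtain ⟨c, hc⟩ := hker _ h2
  have hc0 : c = 0 := by simpa [hpi] using (congrFun hc i).symm
  rw [hc0, zero_smul, planeEmb_eq_zero_iff] at hc
  exact hw0 hc

/-- Write `q^2 a + m b = (q^2 - m) a + m (a + b)` and insert both bounds. The margin left is `(q^2 -
1) m (q^2 - q - 1 + (d - m)(q + 1))`, positive since `q ≥ 2`. -/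
theorem count_inequality {q d m a b : ℕ} (hq : 2 ≤ q) (hm : 1 ≤ m) (hmd : m ≤ d) (hdq : d ≤ q)
    (ha : a ≤ (q ^ 2 - 1) * ((q + 1) * (d - m)))
    (hab : a + b ≤ (q ^ 2 - 1) * (q ^ 3 + q + 1)) :
    q ^ 2 + (q ^ 2 * a + m * b) < 1 + (q ^ 2 - 1) * (1 + q ^ 2 * d * (q + 1)) := by
  have h2 : 1 ≤ q ^ 2 := Nat.one_le_pow _ _ (by omega)
  have hmd' : (m : ℤ) ≤ d := by exact_mod_cast hmd
  zify [h2, hmd] at hq hm hdq ha hab ⊢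
  set Q : ℤ := (q : ℤ) ^ 2 - 1 with hQ
  have hQ0 : 0 < Q := by nlinarith
  have h3 : ((q : ℤ) ^ 2 - m) * a ≤ ((q : ℤ) ^ 2 - m) * (Q * ((q + 1) * (d - m))) :=
    mul_le_mul_of_nonneg_left ha (by nlinarith)
  have h4 : (m : ℤ) * (a + b) ≤ m * (Q * (q ^ 3 + q + 1)) :=
    mul_le_mul_of_nonneg_left hab (by omega)
  have h5 : 0 < (q : ℤ) ^ 2 - q - 1 + (d - m) * (q + 1) := by
    have : 0 ≤ ((d : ℤ) - m) * (q + 1) := mul_nonneg (by omega) (by omega)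
    nlinarith
  have h6 : 0 < Q * (m * ((q : ℤ) ^ 2 - q - 1 + (d - m) * (q + 1))) :=
    mul_pos hQ0 (mul_pos (by omega) h5)
  have h7 : (q : ℤ) ^ 2 = Q + 1 := by rw [hQ]; ring
  nlinarith

/-- If `F` has a monomial that involves the vertex coordinate, then it has fewer zeros on the
Hermitian cone than the cones over the curves with the most points. -/
theorem card_zeros_lt (hK : Fintype.card K = q ^ 2) [DecidableEq K]
    {H : Matrix (Fin 4) (Fin 4) K} (hH : ∀ i j, H i j = H j i ^ q)
    {p : Fin 4 → K} (hp : Matrix.vecMul p H = 0) {i : Fin 4} (hpi : p i = 1)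
    (hker : ∀ v, Matrix.vecMul v H = 0 → ∃ c : K, v = c • p)
    {d : ℕ} (hdq : d ≤ q) {F : MvPolynomial (Fin 4) K} (hF : F.IsHomogeneous d)
    (hdeg : 1 ≤ (lineExpansion (n := 3) p i F).natDegree) :
    (Finset.univ.filter fun v : Fin 4 → K => sesq q H v v = 0 ∧ eval v F = 0).card <
      1 + (q ^ 2 - 1) * (1 + q ^ 2 * d * (q + 1)) := by
  classical
  have hq := two_le_of_card hK
  set f := lineExpansion (n := 3) p i F with hf
  set m := f.natDegree with hm
  set M := H.submatrix i.succAbove i.succAbove with hM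
  have hdet : IsUnit M.det := isUnit_det_submatrix (n := 3) hK hH hp hpi hker
  have hmd : m ≤ d := natDegree_lineExpansion_le (n := 3) p i hF
  have hG : (f.coeff m).IsHomogeneous (d - m) :=
    lineExpansion_coeff_isHomogeneous (n := 3) p i hF hmd
  have hG0 : f.coeff m ≠ 0 := by
    rw [hm, Polynomial.coeff_natDegree, Polynomial.leadingCoeff_ne_zero]
    rintro h0
    rw [hm, h0, Polynomial.natDegree_zero] at hdeg
    omega
  have heval : ∀ (y : Fin 3 → K) (t : K),
      eval (planeEmb i y + t • p) F = (f.map (eval y)).eval t := by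
    intro y t
    rw [Polynomial.eval_map]
    exact eval_lineExpansion (n := 3) (A := K) p i hpi y t F
  have hsesq : ∀ (y : Fin 3 → K) (t : K),
      sesq q H (planeEmb i y + t • p) (planeEmb i y + t • p) = sesq q M y y := by
    intro y t
    rw [sesq_add_smul_self (n := 3) hK hH hp, sesq_planeEmb (n := 3) (by omega)]
  rw [card_filter_eq_sum_lines p i hpi]
  simp_rw [heval, hsesq]
  have hall : ∀ y : Fin 3 → K, (Finset.univ.filter fun t : K =>
      sesq q M y y = 0 ∧ (f.map (eval y)).eval t = 0).card ≤ q ^ 2 :=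
    fun y => (Finset.card_le_univ _).trans hK.le
  set U := Finset.univ.filter fun y : Fin 3 → K => sesq q M y y = 0 ∧ y ≠ 0 with hU
  have hgeneric : ∀ y : Fin 3 → K, eval y (f.coeff m) ≠ 0 → (Finset.univ.filter fun t : K =>
      sesq q M y y = 0 ∧ (f.map (eval y)).eval t = 0).card ≤ m := by
    intro y hy
    have hne : f.map (eval y) ≠ 0 := by
      intro h0
      have := congrArg (fun g => g.coeff m) h0
      simp only [Polynomial.coeff_map, Polynomial.coeff_zero] at this
      exact hy this
    calc _ ≤ (f.map (eval y)).roots.toFinset.card := by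
          refine Finset.card_le_card fun t ht => ?_
          rw [Multiset.mem_toFinset, Polynomial.mem_roots hne]
          exact (Finset.mem_filter.1 ht).2.2
      _ ≤ Multiset.card (f.map (eval y)).roots := Multiset.toFinset_card_le _
      _ ≤ m := (Polynomial.card_roots' _).trans Polynomial.natDegree_map_le
  have hA := card_isotropic_zeros_le hK hdet (show d - m ≤ q by omega) hG hG0
  have hB := card_isotropic_le hK hdet
  have hUA : (U.filter fun y => eval y (f.coeff m) = 0) =
      Finset.univ.filter fun y : Fin 3 → K =>
        sesq q M y y = 0 ∧ eval y (f.coeff m) = 0 ∧ y ≠ 0 := by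
    ext y
    simp only [hU, Finset.mem_filter, Finset.mem_univ, true_and]
    tauto
  rw [← hUA] at hA
  rw [← hU, ← Finset.card_filter_add_card_filter_not (fun y => eval y (f.coeff m) = 0)] at hB
  refine lt_of_le_of_lt ?_ (count_inequality hq hdeg hmd hdq hA hB)
  -- The term `y = 0` is the line of multiples of `p`; it accounts for the summand `q ^ 2`.
  rw [← Finset.add_sum_erase _ _ (Finset.mem_univ 0)]
  refine add_le_add (hall 0) ?_
  have hsub : U ⊆ Finset.univ.erase 0 := fun y hy => by simpa using (Finset.mem_filter.1 hy).2.2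
  rw [← Finset.sum_subset hsub, ← Finset.sum_filter_add_sum_filter_not U
    (fun y => eval y (f.coeff m) = 0)]
  · refine add_le_add ?_ ?_
    · refine (Finset.sum_le_card_nsmul _ _ (q ^ 2) fun y _ => hall y).trans ?_
      rw [smul_eq_mul, mul_comm]
    · refine (Finset.sum_le_card_nsmul _ _ m fun y hy =>
        hgeneric y (Finset.mem_filter.1 hy).2).trans ?_
      rw [smul_eq_mul, mul_comm]
  · intro y hy hyU
    have hne : sesq q M y y ≠ 0 := fun h0 =>
      hyU (Finset.mem_filter.2 ⟨Finset.mem_univ _, h0, Finset.ne_of_mem_erase hy⟩)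
    simp [hne]

end Hermitian

/-! ### Rational points, representing vectors and cones. -/

section Points

variable {K : Type*} [Field K] {n : ℕ}

/-- The vector with coordinates in the algebraic closure of a vector over `K`. -/
noncomputable abbrev toClosure (v : Fin (n + 1) → K) : Fin (n + 1) → AlgebraicClosure K :=
  fun i => algebraMap K (AlgebraicClosure K) (v i)

theorem toClosure_ne_zero {v : Fin (n + 1) → K} : toClosure v ≠ 0 ↔ v ≠ 0 := by
  refine not_congr ⟨fun h => ?_, fun h => ?_⟩
  · ext i
    simpa using congrFun h i
  · ext i
    simp [h]

theorem aeval_toClosure (v : Fin (n + 1) → K) (F : MvPolynomial (Fin (n + 1)) K) :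
    aeval (toClosure v) F = algebraMap K (AlgebraicClosure K) (eval v F) := by
  rw [← aeval_eq_eval, ← aeval_algebraMap_apply]
  rfl

theorem mk_mem_zeroSet {F : MvPolynomial (Fin (n + 1)) K} {d : ℕ} (hF : F.IsHomogeneous d)
    {w : Fin (n + 1) → AlgebraicClosure K} (hw : w ≠ 0) :
    (Projectivization.mk (AlgebraicClosure K) w hw : GeomPoint K n) ∈ zeroSet F ↔
      aeval w F = 0 := by
  obtain ⟨a, ha⟩ := Projectivization.exists_smul_eq_mk_rep (AlgebraicClosure K) w hw
  rw [zeroSet, Set.mem_ofPred_eq, ← ha, Units.smul_def, aeval_smul_of_isHomogeneous hF,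
    mul_eq_zero, or_iff_right (pow_ne_zero _ a.ne_zero)]

theorem mk_toClosure_mem_zeroSet {F : MvPolynomial (Fin (n + 1)) K} {d : ℕ}
    (hF : F.IsHomogeneous d) {v : Fin (n + 1) → K} (hv : toClosure v ≠ 0) :
    (Projectivization.mk (AlgebraicClosure K) _ hv : GeomPoint K n) ∈ zeroSet F ↔
      eval v F = 0 := by
  rw [mk_mem_zeroSet hF, aeval_toClosure, map_eq_zero]

theorem mk_toClosure_mem_hermitianVariety (q : ℕ) (H : Matrix (Fin (n + 1)) (Fin (n + 1)) K)
    {v : Fin (n + 1) → K} (hv : toClosure v ≠ 0) :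
    (Projectivization.mk (AlgebraicClosure K) _ hv : GeomPoint K n) ∈ hermitianVariety q H ↔
      sesq q H v v = 0 := by
  rw [hermitianVariety, mk_toClosure_mem_zeroSet (hermitianPoly_isHomogeneous q H),
    eval_hermitianPoly]

/-- The number of nonzero vectors over `K` that represent the rational points of `Z`. -/
theorem card_vectors_eq [Fintype K] (Z : Set (GeomPoint K n)) (S : Finset (Fin (n + 1) → K))
    (hS : ∀ v, v ∈ S ↔ ∃ hv : toClosure v ≠ 0,
      (Projectivization.mk (AlgebraicClosure K) _ hv : GeomPoint K n) ∈ Z) :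
    S.card = (Fintype.card K - 1) * (rationalPoints Z).ncard := by
  classical
  -- The value at the zero vector is arbitrary; `S` contains only nonzero vectors.
  let f : (Fin (n + 1) → K) → GeomPoint K n := fun v =>
    if hv : toClosure v ≠ 0 then Projectivization.mk (AlgebraicClosure K) _ hv
    else Classical.arbitrary _
  have hf : ∀ v (hv : toClosure v ≠ 0), f v = Projectivization.mk (AlgebraicClosure K) _ hv :=
    fun v hv => dif_pos hv
  have himage : rationalPoints Z = (S.image f : Finset (GeomPoint K n)) := by
    ext x
    simp only [rationalPoints, Set.mem_ofPred_eq, Finset.coe_image, Set.mem_image,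
      Finset.mem_coe, hS]
    constructor
    · rintro ⟨hx, v, hv, rfl⟩
      exact ⟨v, ⟨hv, hx⟩, hf v hv⟩
    · rintro ⟨v, ⟨hv, hx⟩, rfl⟩
      rw [hf v hv]
      exact ⟨hx, v, hv, rfl⟩
  rw [himage, Set.ncard_coe_finset, Finset.card_eq_sum_card_image f S, ← Fintype.card_units,
    mul_comm, ← smul_eq_mul]
  refine Finset.sum_const_nat fun x hx => ?_
  obtain ⟨v, hvS, rfl⟩ := Finset.mem_image.1 hx
  obtain ⟨hv, hvZ⟩ := (hS v).1 hvS
  have hv0 := toClosure_ne_zero.1 hv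
  have hfib : S.filter (fun a => f a = f v) = Finset.univ.image fun u : Kˣ => u • v := by
    ext a
    simp only [Finset.mem_filter, Finset.mem_image, Finset.mem_univ, true_and]
    constructor
    · rintro ⟨haS, hav⟩
      obtain ⟨ha, -⟩ := (hS a).1 haS
      rw [hf a ha, hf v hv, Projectivization.mk_eq_mk_iff'] at hav
      obtain ⟨c, hc⟩ := hav
      obtain ⟨i, hi⟩ := Function.ne_iff.1 hv0
      -- The scalar relating two vectors over `K` is a ratio of coordinates, so it lies in `K`.
      have hci : c = algebraMap K (AlgebraicClosure K) (a i / v i) := by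
        have := congrFun hc i
        rw [map_div₀, eq_div_iff (by simpa using hi)]
        exact this
      have hav : (a i / v i) • v = a := by
        ext k
        apply (algebraMap K (AlgebraicClosure K)).injective
        have := congrFun hc k
        rw [hci] at this
        simpa using this
      have hne : a i / v i ≠ 0 := by
        intro h0
        rw [h0, zero_smul] at hav
        exact toClosure_ne_zero.1 ha hav.symm
      exact ⟨Units.mk0 _ hne, hav⟩
    · rintro ⟨u, rfl⟩
      have hu : toClosure (u • v) ≠ 0 :=
        toClosure_ne_zero.2 (by rw [Ne, smul_eq_zero_iff_eq]; exact hv0)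
      have heq : f (u • v) = f v := by
        rw [hf _ hu, hf v hv, Projectivization.mk_eq_mk_iff']
        refine ⟨algebraMap K (AlgebraicClosure K) u, ?_⟩
        ext k
        exact (map_mul _ _ _).symm
      refine ⟨(hS _).2 ⟨hu, ?_⟩, heq⟩
      rwa [← hf _ hu, heq, hf v hv]
  rw [hfib, Finset.card_image_of_injective, Finset.card_univ]
  intro a b hab
  have := (smul_left_injective K hv0) (show (a : K) • v = (b : K) • v from hab)
  exact Units.ext this

theorem aeval_add_of_isHomogeneous_one {A : Type*} [CommRing A] [Algebra K A]
    {l : MvPolynomial (Fin (n + 1)) K} (hl : l.IsHomogeneous 1) (u v : Fin (n + 1) → A) :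
    aeval (u + v) l = aeval u l + aeval v l := by
  have h : l ∈ homogeneousSubmodule (Fin (n + 1)) K 1 := hl
  rw [homogeneousSubmodule_one_eq_span_X] at h
  clear hl
  induction h using Submodule.span_induction with
  | mem x hx => obtain ⟨i, rfl⟩ := hx; simp
  | zero => simp
  | add x y _ _ hx hy =>
    rw [map_add, map_add, map_add, hx, hy]
    ring
  | smul c x _ hx => rw [map_smul, map_smul, map_smul, hx, smul_add]

/-- The points of the cone over a subset of a hyperplane that does not contain the vertex. -/
theorem mk_mem_cone_iff {l : MvPolynomial (Fin (n + 1)) K} (hl : l.IsHomogeneous 1)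
    {C : Set (GeomPoint K n)} (hC : C ⊆ zeroSet l) (hne : C.Nonempty)
    {p y w : Fin (n + 1) → AlgebraicClosure K} (hp : p ≠ 0) (hlp : aeval p l ≠ 0)
    (hly : aeval y l = 0) {t : AlgebraicClosure K} (hw : w ≠ 0) (hwy : w = y + t • p) :
    (Projectivization.mk (AlgebraicClosure K) w hw : GeomPoint K n) ∈
        cone (Projectivization.mk (AlgebraicClosure K) p hp) C ↔
      y = 0 ∨ ∃ hy : y ≠ 0, (Projectivization.mk (AlgebraicClosure K) y hy : GeomPoint K n) ∈ C := by
  constructor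
  · rintro ⟨z, hz, hle⟩
    rw [or_iff_not_imp_left]
    intro hy
    refine ⟨hy, ?_⟩
    rw [Projectivization.submodule_mk, Projectivization.submodule_mk,
      Projectivization.submodule_eq, Submodule.span_singleton_le_iff_mem, Submodule.mem_sup] at hle
    obtain ⟨u, hu, v, hv, huv⟩ := hle
    obtain ⟨α, rfl⟩ := Submodule.mem_span_singleton.1 hu
    obtain ⟨β, rfl⟩ := Submodule.mem_span_singleton.1 hv
    have hlz : aeval z.rep l = 0 := hC hz
    have h1 : aeval (α • p + β • z.rep) l = aeval (y + t • p) l := by rw [huv, hwy]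
    rw [aeval_add_of_isHomogeneous_one hl, aeval_add_of_isHomogeneous_one hl,
      aeval_smul_of_isHomogeneous hl, aeval_smul_of_isHomogeneous hl,
      aeval_smul_of_isHomogeneous hl, hlz, hly, mul_zero, add_zero, zero_add, pow_one, pow_one] at h1
    have h2 : α = t := mul_right_cancel₀ hlp h1
    have h3 : β • z.rep = y := by
      rw [hwy, h2, add_comm y] at huv
      exact add_left_cancel huv
    have h4 : (Projectivization.mk (AlgebraicClosure K) y hy : GeomPoint K n) = z := by
      rw [← z.mk_rep, Projectivization.mk_eq_mk_iff']
      exact ⟨β, h3⟩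
    rwa [h4]
  · rintro (rfl | ⟨hy, hyC⟩)
    -- Here the point is the vertex itself, which lies on the cone only because `C` is nonempty.
    · obtain ⟨z, hz⟩ := hne
      refine ⟨z, hz, ?_⟩
      rw [Projectivization.submodule_mk, Projectivization.submodule_mk,
        Submodule.span_singleton_le_iff_mem]
      apply Submodule.mem_sup_left
      rw [hwy, zero_add]
      exact Submodule.smul_mem _ _ (Submodule.mem_span_singleton_self _)
    · refine ⟨_, hyC, ?_⟩
      rw [Projectivization.submodule_mk, Projectivization.submodule_mk,
        Projectivization.submodule_mk, Submodule.span_singleton_le_iff_mem, hwy, add_comm y]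
      exact Submodule.add_mem_sup (Submodule.smul_mem _ _ (Submodule.mem_span_singleton_self _))
        (Submodule.mem_span_singleton_self _)

/-- Projection from `p` to the plane `l = 0` is defined over `K` and preserves the Hermitian form.
Each rational point of the base therefore contributes a line with `q ^ 2` rational points besides
the vertex. -/
theorem ncard_rationalPoints_cone [Fintype K] {q : ℕ} (hK : Fintype.card K = q ^ 2)
    {H : Matrix (Fin (n + 1)) (Fin (n + 1)) K} (hH : ∀ i j, H i j = H j i ^ q)
    {p : Fin (n + 1) → K} (hp : Matrix.vecMul p H = 0) (hp0 : toClosure p ≠ 0)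
    {l : MvPolynomial (Fin (n + 1)) K} (hl : l.IsHomogeneous 1) (hlp : eval p l ≠ 0)
    {C : Set (GeomPoint K n)} (hC : C ⊆ zeroSet l) (hne : C.Nonempty) :
    (rationalPoints (hermitianVariety q H ∩
      cone (Projectivization.mk (AlgebraicClosure K) _ hp0) C)).ncard =
      1 + q ^ 2 * (rationalPoints (C ∩ hermitianVariety q H)).ncard := by
  classical
  have hq := two_le_of_card hK
  have hp0' := toClosure_ne_zero.1 hp0
  let S : Finset (Fin (n + 1) → K) := Finset.univ.filter fun v => ∃ hv : toClosure v ≠ 0,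
    (Projectivization.mk (AlgebraicClosure K) _ hv : GeomPoint K n) ∈ hermitianVariety q H ∩
      cone (Projectivization.mk (AlgebraicClosure K) _ hp0) C
  let T : Finset (Fin (n + 1) → K) := Finset.univ.filter fun v => ∃ hv : toClosure v ≠ 0,
    (Projectivization.mk (AlgebraicClosure K) _ hv : GeomPoint K n) ∈ C ∩ hermitianVariety q H
  have hS := card_vectors_eq (hermitianVariety q H ∩
    cone (Projectivization.mk (AlgebraicClosure K) _ hp0) C) S fun v => by
      simp only [S, Finset.mem_filter, Finset.mem_univ, true_and]
  have hT := card_vectors_eq (C ∩ hermitianVariety q H) T fun v => by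
    simp only [T, Finset.mem_filter, Finset.mem_univ, true_and]
  have hlp' : aeval (toClosure p) l ≠ 0 := by
    rw [aeval_toClosure]; simpa using hlp
  have hTl : ∀ y ∈ T, eval y l = 0 := by
    intro y hy
    obtain ⟨hy0, hyC, -⟩ := (Finset.mem_filter.1 hy).2
    exact (mk_toClosure_mem_zeroSet hl hy0).1 (hC hyC)
  have hladd : ∀ (y : Fin (n + 1) → K) (t : K), eval (y + t • p) l = eval y l + t * eval p l := by
    intro y t
    have h1 := aeval_add_of_isHomogeneous_one hl y (t • p)
    rwa [aeval_smul_of_isHomogeneous hl, pow_one] at h1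
  -- Vectors of the vertex, together with the translates `y + t p` of the vectors `y` of the base.
  have hunion : S = (Finset.univ.erase (0 : K)).image (fun t => t • p) ∪
      (T ×ˢ (Finset.univ : Finset K)).image (fun x => x.1 + x.2 • p) := by
    ext v
    obtain ⟨y, t, hly, hvy⟩ : ∃ (y : Fin (n + 1) → K) (t : K), eval y l = 0 ∧ v = y + t • p := by
      refine ⟨v - (eval v l / eval p l) • p, eval v l / eval p l, ?_, by simp⟩
      rw [sub_eq_add_neg, ← neg_smul, hladd]
      field_simp
      ring
    have hly' : aeval (toClosure y) l = 0 := by rw [aeval_toClosure, hly, map_zero]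
    have hvy' : toClosure v =
        toClosure y + algebraMap K (AlgebraicClosure K) t • toClosure p := by
      ext k
      rw [hvy]
      exact (map_add (algebraMap K (AlgebraicClosure K)) _ _).trans
        (congrArg _ (map_mul (algebraMap K (AlgebraicClosure K)) t (p k)))
    have hsesq : sesq q H v v = sesq q H y y := by rw [hvy, sesq_add_smul_self hK hH hp]
    have hSv : v ∈ S ↔ v ≠ 0 ∧ (y = 0 ∨ y ∈ T) := by
      simp only [S, T, Finset.mem_filter, Finset.mem_univ, true_and]
      constructor
      · rintro ⟨hv, hherm, hcone⟩
        refine ⟨toClosure_ne_zero.1 hv, ?_⟩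
        rw [mk_mem_cone_iff hl hC hne hp0 hlp' hly' hv hvy'] at hcone
        rw [mk_toClosure_mem_hermitianVariety, hsesq] at hherm
        rcases hcone with h0 | ⟨hy0, hyC⟩
        · exact Or.inl (not_not.1 fun h => toClosure_ne_zero.2 h h0)
        · exact Or.inr ⟨hy0, hyC, (mk_toClosure_mem_hermitianVariety q H hy0).2 hherm⟩
      · rintro ⟨hv, hy⟩
        have hv' := toClosure_ne_zero.2 hv
        refine ⟨hv', ?_, ?_⟩
        · rw [mk_toClosure_mem_hermitianVariety, hsesq]
          rcases hy with rfl | ⟨hy0, -, hy⟩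
          · simp [sesq]
          · exact (mk_toClosure_mem_hermitianVariety q H hy0).1 hy
        · rw [mk_mem_cone_iff hl hC hne hp0 hlp' hly' hv' hvy']
          rcases hy with rfl | ⟨hy0, hyC, -⟩
          · left
            ext k
            simp
          · exact Or.inr ⟨hy0, hyC⟩
    rw [hSv]
    simp only [Finset.mem_union, Finset.mem_image, Finset.mem_erase, Finset.mem_univ, and_true,
      Finset.mem_product, Prod.exists]
    constructor
    · rintro ⟨hv, rfl | hy⟩
      · rw [zero_add] at hvy
        refine Or.inl ⟨t, ?_, hvy.symm⟩
        rintro rfl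
        exact hv (by rw [hvy, zero_smul])
      · exact Or.inr ⟨y, t, hy, hvy.symm⟩
    · have huniq : ∀ (z : Fin (n + 1) → K) (s : K), eval z l = 0 → z + s • p = v → z = y := by
        intro z s hz hzv
        have h1 : eval (z + s • p) l = eval (y + t • p) l := by rw [hzv, hvy]
        rw [hladd, hladd, hz, hly, zero_add, zero_add] at h1
        rw [hvy, mul_right_cancel₀ hlp h1] at hzv
        exact add_right_cancel hzv
      rintro (⟨s, hs, hsv⟩ | ⟨z, s, hz, hzv⟩)
      · refine ⟨?_, Or.inl (huniq 0 s ?_ (by rw [zero_add, hsv])).symm⟩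
        · rw [← hsv]
          exact smul_ne_zero hs hp0'
        · have h2 := aeval_smul_of_isHomogeneous hl (0 : K) p
          rwa [zero_smul, pow_one, zero_mul] at h2
      · have hzy := huniq z s (hTl z hz) hzv
        subst hzy
        refine ⟨?_, Or.inr hz⟩
        rintro rfl
        have h1 : eval (z + s • p) l = eval (0 + (0 : K) • p) l := by rw [hzv]; simp
        have h2 := aeval_smul_of_isHomogeneous hl (0 : K) p
        rw [zero_smul, pow_one, zero_mul, aeval_eq_eval] at h2
        rw [hladd, hladd, hTl z hz, h2] at h1
        have h3 : s = 0 := mul_right_cancel₀ hlp (by simpa using h1)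
        rw [h3, zero_smul, add_zero] at hzv
        obtain ⟨hz0, -⟩ := (Finset.mem_filter.1 hz).2
        exact toClosure_ne_zero.1 hz0 hzv
  have hdisj : Disjoint ((Finset.univ.erase (0 : K)).image (fun t => t • p))
      ((T ×ˢ (Finset.univ : Finset K)).image (fun x => x.1 + x.2 • p)) := by
    rw [Finset.disjoint_left]
    rintro v hv1 hv2
    obtain ⟨t, -, rfl⟩ := Finset.mem_image.1 hv1
    obtain ⟨⟨z, s⟩, hzs, hz⟩ := Finset.mem_image.1 hv2
    have hzT := (Finset.mem_product.1 hzs).1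
    simp only at hz hzT
    have hz' : z = 0 + (t - s) • p := by
      rw [sub_smul, zero_add, eq_sub_iff_add_eq, hz]
    have h2 := aeval_smul_of_isHomogeneous hl (0 : K) p
    rw [zero_smul, pow_one, zero_mul, aeval_eq_eval] at h2
    have h1 := hTl z hzT
    rw [hz', hladd, h2, zero_add, mul_eq_zero, or_iff_left hlp] at h1
    rw [h1, zero_smul, add_zero] at hz'
    obtain ⟨hz0, -⟩ := (Finset.mem_filter.1 hzT).2
    exact toClosure_ne_zero.1 hz0 hz'
  have hcard : S.card = (q ^ 2 - 1) + T.card * q ^ 2 := by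
    rw [hunion, Finset.card_union_of_disjoint hdisj, Finset.card_image_of_injective _
      (smul_left_injective K hp0'), Finset.card_image_of_injOn, Finset.card_product,
      Finset.card_univ, Finset.card_erase_of_mem (Finset.mem_univ _), Finset.card_univ, hK]
    rintro ⟨y, t⟩ hy ⟨z, s⟩ hz hyz
    have hy' := hTl y (Finset.mem_product.1 hy).1
    have hz' := hTl z (Finset.mem_product.1 hz).1
    simp only at hyz
    have h1 : eval (y + t • p) l = eval (z + s • p) l := by rw [hyz]
    rw [hladd, hladd, hy', hz', zero_add, zero_add] at h1
    have h2 := mul_right_cancel₀ hlp h1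
    rw [h2] at hyz ⊢
    rw [add_right_cancel hyz]
  rw [hS, hT, hK] at hcard
  have h1 : 1 < q ^ 2 := Nat.one_lt_pow (by omega) (by omega)
  refine Nat.eq_of_mul_eq_mul_left (show 0 < q ^ 2 - 1 by omega) ?_
  rw [hcard]
  ring

end Points

/-! ### The vertex, and forms constant along the lines through it. -/

section Vertex

variable {K : Type*} [Field K]

/-- The left kernel of a matrix of corank one is spanned by a vector with a coordinate `1`. -/
theorem exists_vertex {n : ℕ} {H : Matrix (Fin (n + 1)) (Fin (n + 1)) K} (hrank : H.rank = n) :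
    ∃ (p : Fin (n + 1) → K) (i : Fin (n + 1)), Matrix.vecMul p H = 0 ∧ p i = 1 ∧
      ∀ v, Matrix.vecMul v H = 0 → ∃ c : K, v = c • p := by
  have h1 := LinearMap.finrank_range_add_finrank_ker H.transpose.mulVecLin
  have h2 : Module.finrank K (LinearMap.range H.transpose.mulVecLin) = n :=
    H.rank_transpose.trans hrank
  rw [h2, Module.finrank_fin_fun, Nat.add_left_cancel_iff, finrank_eq_one_iff'] at h1
  obtain ⟨⟨v, hv⟩, hv0, hspan⟩ := h1
  have hv0' : v ≠ 0 := fun h => hv0 (Subtype.ext h)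
  obtain ⟨i, hi⟩ := Function.ne_iff.1 hv0'
  simp only [Pi.zero_apply] at hi
  rw [LinearMap.mem_ker, Matrix.mulVecLin_apply, Matrix.mulVec_transpose] at hv
  refine ⟨(v i)⁻¹ • v, i, ?_, by simp [hi], fun w hw => ?_⟩
  · rw [Matrix.smul_vecMul, hv, smul_zero]
  · obtain ⟨c, hc⟩ := hspan ⟨w, by
      rw [LinearMap.mem_ker, Matrix.mulVecLin_apply, Matrix.mulVec_transpose, hw]⟩
    refine ⟨c * v i, ?_⟩
    rw [smul_smul, mul_assoc, mul_inv_cancel₀ hi, mul_one]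
    exact (congrArg Subtype.val hc).symm

/-- The vertex of the Hermitian cone is the only geometric point of the singular space. -/
theorem eq_mk_of_mem_singularSpace {n : ℕ} {H : Matrix (Fin (n + 1)) (Fin (n + 1)) K}
    {p : Fin (n + 1) → K} {i : Fin (n + 1)} (hp : Matrix.vecMul p H = 0) (hpi : p i = 1)
    (hdet : IsUnit (H.submatrix i.succAbove i.succAbove).det) (hp0 : toClosure p ≠ 0)
    {P : GeomPoint K n} (hP : P ∈ singularSpace H) :
    P = Projectivization.mk (AlgebraicClosure K) _ hp0 := by
  set ι := algebraMap K (AlgebraicClosure K) with hι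
  have hpi' : toClosure p i = 1 := by simp [hpi]
  obtain ⟨⟨y, t⟩, hyt⟩ := (coneEquiv (toClosure p) i hpi').surjective P.rep
  rw [coneEquiv_apply] at hyt
  have hp' : Matrix.vecMul (toClosure p) (H.map ι) = 0 := by
    ext j
    have := congrArg ι (congrFun hp j)
    simpa [Matrix.vecMul, dotProduct, map_sum] using this
  have h1 : Matrix.vecMul (planeEmb i y) (H.map ι) = 0 := by
    have h2 : Matrix.vecMul P.rep (H.map ι) = 0 := hP
    rwa [← hyt, Matrix.add_vecMul, Matrix.smul_vecMul, hp', smul_zero, add_zero] at h2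
  have h3 : Matrix.vecMul y ((H.submatrix i.succAbove i.succAbove).map ι) = 0 := by
    ext j
    have := congrFun h1 (i.succAbove j)
    simpa [Matrix.vecMul, dotProduct, Fin.sum_univ_succAbove _ i] using this
  have hy : y = 0 := by
    by_contra hy
    -- The minor stays invertible over the algebraic closure, so the singular space gains no
    -- geometric points.
    have h4 := Matrix.exists_vecMul_eq_zero_iff.1 ⟨y, hy, h3⟩
    have h5 := (ι.map_det (H.submatrix i.succAbove i.succAbove)).symm
    rw [RingHom.mapMatrix_apply, h4] at h5
    exact hdet.ne_zero ((map_eq_zero ι).1 h5.symm)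
  rw [hy, planeEmb_zero, zero_add] at hyt
  rw [← P.mk_rep, Projectivization.mk_eq_mk_iff']
  exact ⟨t, hyt⟩

end Vertex

/-- If `F` does not involve the vertex coordinate then `V(F)` is a cone. -/
theorem zeroSet_eq_cone {K : Type*} [Field K] {n d : ℕ} (hd : 1 ≤ d)
    {F : MvPolynomial (Fin (n + 1)) K} (hF : F.IsHomogeneous d)
    {p : Fin (n + 1) → K} {i : Fin (n + 1)} (hpi : p i = 1)
    (hp0 : toClosure p ≠ 0) (hdeg : (lineExpansion p i F).natDegree = 0)
    {x : GeomPoint K n} (hx : x ∈ zeroSet F)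
    (hxp : x ≠ Projectivization.mk (AlgebraicClosure K) _ hp0) :
    zeroSet F = cone (Projectivization.mk (AlgebraicClosure K) _ hp0)
      (zeroSet (X i) ∩ zeroSet F) := by
  have hpi' : toClosure p i = 1 := by simp [hpi]
  have hX : (X i : MvPolynomial (Fin (n + 1)) K).IsHomogeneous 1 := isHomogeneous_X _ _
  have heval : ∀ (y : Fin n → AlgebraicClosure K) (t : AlgebraicClosure K),
      aeval (planeEmb i y + t • toClosure p) F = aeval (planeEmb i y) F := by
    intro y t
    have h1 := eval_lineExpansion p i hpi y t F
    have h2 := eval_lineExpansion p i hpi y 0 F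
    rw [Polynomial.eq_C_of_natDegree_eq_zero hdeg, Polynomial.eval₂_C] at h1 h2
    rw [zero_smul, add_zero] at h2
    exact h1.trans h2.symm
  have hmem : ∀ (y : Fin n → AlgebraicClosure K) (hy : planeEmb i y ≠ 0),
      (Projectivization.mk (AlgebraicClosure K) (planeEmb i y) hy : GeomPoint K n) ∈
        zeroSet (X i) ∩ zeroSet F ↔ aeval (planeEmb i y) F = 0 := by
    intro y hy
    rw [Set.mem_inter_iff, mk_mem_zeroSet hX, mk_mem_zeroSet hF, aeval_X, planeEmb_self]
    simp
  -- The zero `x` projects from the vertex to a point of the base curve.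
  have hne : (zeroSet (X i) ∩ zeroSet F : Set (GeomPoint K n)).Nonempty := by
    obtain ⟨⟨y, t⟩, hyt⟩ := (coneEquiv (toClosure p) i hpi').surjective x.rep
    rw [coneEquiv_apply] at hyt
    have hy : planeEmb i y ≠ 0 := by
      intro hy
      apply hxp
      rw [hy, zero_add] at hyt
      rw [← x.mk_rep, Projectivization.mk_eq_mk_iff']
      exact ⟨t, hyt⟩
    refine ⟨_, (hmem y hy).2 ?_⟩
    rw [← heval y t, hyt]
    exact hx
  ext z
  obtain ⟨⟨y, t⟩, hyt⟩ := (coneEquiv (toClosure p) i hpi').surjective z.rep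
  rw [coneEquiv_apply] at hyt
  rw [← z.mk_rep, mk_mem_zeroSet hF, mk_mem_cone_iff hX Set.inter_subset_left hne hp0
    (by rw [aeval_X, hpi']; exact one_ne_zero) (y := planeEmb i y) (by simp) _ hyt.symm,
    ← hyt, heval]
  constructor
  · intro h
    rw [or_iff_not_imp_left]
    exact fun hy => ⟨hy, (hmem y hy).2 h⟩
  · rintro (h | ⟨hy, h⟩)
    · have h2 := aeval_smul_of_isHomogeneous hF (0 : AlgebraicClosure K) (toClosure p)
      rw [zero_smul, zero_pow (by omega), zero_mul] at h2
      rw [h, h2]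
    · exact (hmem y hy).1 h

/-- A form that does not involve the vertex coordinate does not vanish on the base plane. -/
theorem not_subset_zeroSet {K : Type*} [Field K] {n d : ℕ} (hd : 1 ≤ d)
    {F : MvPolynomial (Fin (n + 1)) K} (hF : F.IsHomogeneous d) (hF0 : F ≠ 0)
    {p : Fin (n + 1) → K} {i : Fin (n + 1)} (hpi : p i = 1)
    (hdeg : (lineExpansion p i F).natDegree = 0) :
    ¬ (zeroSet (X i) : Set (GeomPoint K n)) ⊆ zeroSet F := by
  intro hsub
  have hX : (X i : MvPolynomial (Fin (n + 1)) K).IsHomogeneous 1 := isHomogeneous_X _ _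
  have hzero : ∀ y : Fin n → AlgebraicClosure K, aeval (planeEmb i y) F = 0 := by
    intro y
    by_cases hy : planeEmb i y = 0
    · have h2 := aeval_smul_of_isHomogeneous hF (0 : AlgebraicClosure K) (planeEmb i y)
      rw [zero_smul, zero_pow (by omega), zero_mul] at h2
      rw [hy, h2]
    · rw [← mk_mem_zeroSet hF hy]
      apply hsub
      rw [mk_mem_zeroSet hX, aeval_X, planeEmb_self]
  have hcoeff : (lineExpansion p i F).coeff 0 = 0 := by
    apply map_injective (algebraMap K (AlgebraicClosure K))
      (algebraMap K (AlgebraicClosure K)).injective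
    rw [map_zero]
    -- The algebraic closure is infinite, so vanishing at all its points implies vanishing as a
    -- polynomial.
    apply MvPolynomial.funext
    intro y
    have h2 := eval_lineExpansion p i hpi y 0 F
    rw [Polynomial.eq_C_of_natDegree_eq_zero hdeg, Polynomial.eval₂_C, zero_smul, add_zero,
      hzero] at h2
    rw [eval_map, map_zero]
    exact h2.symm
  apply hF0
  apply lineExpansion_injective p i hpi
  rw [map_zero, Polynomial.eq_C_of_natDegree_eq_zero hdeg, hcoeff, map_zero]

end HermitianCone

/-! ### The case of equality. -/

theorem mainTheorem5 {K : Type*} [Field K] [Fintype K] (q : ℕ) (hK : Fintype.card K = q ^ 2)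
    (H : Matrix (Fin 4) (Fin 4) K) (hH : HermitianCone.IsHermitianMatrix (n := 3) q H)
    (hrank : H.rank = 3)
    (P : HermitianCone.GeomPoint K 3) (hP : P ∈ HermitianCone.singularSpace (n := 3) H)
    (d : ℕ) (hd : 1 ≤ d) (hdq : d ≤ q)
    (F : MvPolynomial (Fin 4) K) (hF : F.IsHomogeneous d) (hF0 : F ≠ 0) :
    (HermitianCone.rationalPoints
        (HermitianCone.hermitianVariety (n := 3) q H ∩ HermitianCone.zeroSet (n := 3) F)).ncard
      = 1 + q ^ 2 * d * (q + 1) ↔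
    ∃ E C : Set (HermitianCone.GeomPoint K 3),
      HermitianCone.IsHyperplane E ∧ P ∉ E ∧ HermitianCone.IsHypersurfaceIn E C ∧
      HermitianCone.zeroSet (n := 3) F = HermitianCone.cone P C ∧
      (HermitianCone.rationalPoints
        (C ∩ HermitianCone.hermitianVariety (n := 3) q H)).ncard = d * (q + 1) := by
  classical
  open HermitianCone in
  have hq := two_le_of_card hK
  have hq2 : 0 < q ^ 2 := by positivity
  obtain ⟨p, i, hp, hpi, hker⟩ := exists_vertex (n := 3) hrank
  have hp0 : toClosure (n := 3) p ≠ 0 := toClosure_ne_zero.2 (by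
    rintro rfl
    simp at hpi)
  have hdet := isUnit_det_submatrix (n := 3) hK hH.2 hp hpi hker
  obtain rfl := eq_mk_of_mem_singularSpace (n := 3) hp hpi hdet hp0 hP
  constructor
  · intro hcount
    have hX : (MvPolynomial.X i : MvPolynomial (Fin 4) K).IsHomogeneous 1 :=
      MvPolynomial.isHomogeneous_X _ _
    have hXp : MvPolynomial.eval p (MvPolynomial.X i) ≠ 0 := by
      rw [MvPolynomial.eval_X, hpi]
      exact one_ne_zero
    have hdeg : (lineExpansion (n := 3) p i F).natDegree = 0 := by
      by_contra hne
      have hlt := card_zeros_lt hK hH.2 hp hpi hker hdq hF (Nat.one_le_iff_ne_zero.2 hne)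
      -- The strict bound counts the zero vector as well; it is removed before passing to projective
      -- points.
      have hmem0 : (0 : Fin 4 → K) ∈ Finset.univ.filter fun v : Fin 4 → K =>
          sesq q H v v = 0 ∧ MvPolynomial.eval v F = 0 := by
        refine Finset.mem_filter.2 ⟨Finset.mem_univ _, by simp [sesq], ?_⟩
        have h2 := aeval_smul_of_isHomogeneous hF (0 : K) p
        rwa [zero_smul, zero_pow (by omega), zero_mul] at h2
      have hvec := card_vectors_eq (n := 3) (hermitianVariety q H ∩ zeroSet F)
        ((Finset.univ.filter fun v : Fin 4 → K =>
          sesq q H v v = 0 ∧ MvPolynomial.eval v F = 0).erase 0) (fun v => by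
          simp only [Finset.mem_erase, Finset.mem_filter, Finset.mem_univ, true_and]
          constructor
          · rintro ⟨hv, h1, h2⟩
            have hv' := toClosure_ne_zero (n := 3).2 hv
            exact ⟨hv', (mk_toClosure_mem_hermitianVariety (n := 3) q H hv').2 h1,
              (mk_toClosure_mem_zeroSet (n := 3) hF hv').2 h2⟩
          · rintro ⟨hv, h1, h2⟩
            exact ⟨toClosure_ne_zero.1 hv,
              (mk_toClosure_mem_hermitianVariety (n := 3) q H hv).1 h1,
              (mk_toClosure_mem_zeroSet (n := 3) hF hv).1 h2⟩)
      rw [hcount, Finset.card_erase_of_mem hmem0, hK] at hvec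
      have hpos := Finset.card_pos.2 ⟨_, hmem0⟩
      generalize (q ^ 2 - 1) * (1 + q ^ 2 * d * (q + 1)) = N at hlt hvec
      omega
    -- The count exceeds 1, so some zero of `F` differs from the vertex.
    obtain ⟨x, hx, hxp⟩ := Set.exists_ne_of_one_lt_ncard (s := rationalPoints
      (hermitianVariety (n := 3) q H ∩ zeroSet (n := 3) F)) (by
        rw [hcount]
        have : 0 < q ^ 2 * d * (q + 1) := by positivity
        omega) (Projectivization.mk (AlgebraicClosure K) _ hp0)
    have hcone := zeroSet_eq_cone (n := 3) hd hF hpi hp0 hdeg hx.1.2 hxp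
    have hnonempty : (zeroSet (MvPolynomial.X i) ∩ zeroSet F : Set (GeomPoint K 3)).Nonempty := by
      have hx2 := hx.1.2
      rw [hcone] at hx2
      obtain ⟨z, hz, -⟩ := hx2
      exact ⟨z, hz⟩
    refine ⟨zeroSet (MvPolynomial.X i), zeroSet (MvPolynomial.X i) ∩ zeroSet F,
      ⟨_, hX, MvPolynomial.X_ne_zero i, rfl⟩, ?_,
      ⟨d, F, hd, hF, not_subset_zeroSet (n := 3) hd hF hF0 hpi hdeg, rfl⟩, hcone, ?_⟩
    · rw [mk_toClosure_mem_zeroSet (n := 3) hX]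
      exact hXp
    · have h := ncard_rationalPoints_cone (n := 3) hK hH.2 hp hp0 hX hXp
        Set.inter_subset_left hnonempty
      rw [← hcone, hcount, Nat.add_left_cancel_iff, mul_assoc] at h
      exact (Nat.eq_of_mul_eq_mul_left hq2 h).symm
  · rintro ⟨E, C, ⟨l, hl, -, rfl⟩, hPE, ⟨e, G, -, -, -, hCG⟩, hcone, hcount⟩
    rw [mk_toClosure_mem_zeroSet (n := 3) hl] at hPE
    -- An empty `C` would have `0` points instead of `d * (q + 1) > 0`.
    have hne : C.Nonempty := by
      rw [Set.nonempty_iff_ne_empty]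
      rintro rfl
      have : 0 < d * (q + 1) := by positivity
      simp [rationalPoints] at hcount
      omega
    rw [hcone, ncard_rationalPoints_cone (n := 3) hK hH.2 hp hp0 hl hPE
      (hCG ▸ Set.inter_subset_left) hne, hcount, mul_assoc]
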